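/- Let $d\ge 1$ be an integer. For $n\ge 1$ let $P_{n,d}$ be the graph on $\{0,1,\dots,n\}$, and $P_{\infty,d}$ the graph on $\{0,1,2,\dots\}$, in which $i$ and $j$ are adjacent if and only if $|i-j|\in\{1,3,\dots,2d+1\}$. For $G$ one of these graphs let $\mathrm{Hom}(G,0)$ be the set of all $f\colon V(G)\to\mathbb{Z}$ with $f(0)=0$ and $|f(i)-f(j)|=1$ whenever $i,j$ are adjacent. There is a probability measure $\mu_{\infty,d}$ on $\mathrm{Hom}(P_{\infty,d},0)$ (with the product $\sigma$-algebra) such that, if $f_{n,d}$ is uniform on $\mathrm{Hom}(P_{n,d},0)$ and $f_{\infty,d}$ has law $\mu_{\infty,d}$, then for every $r\ge 0$ and every $f\in\mathbb{Z}^{\{0,1,\dots,r\}}$ $$\Pr\big(f_{n,d}|_{\{0,\dots,r\}}=f\big)\longrightarrow \Pr\big(f_{\infty,d}|_{\{0,\dots,r\}}=f\big)\qquad(n\to\infty).$$ Moreover $\mu_{\infty,d}$ is given explicitly as follows. (i) *Words.* Let $\Sigma=\{a,b,A,B\}$ with $a=(1,-1)$, $b=(-1,1)$, $A=(1,1,-1)$,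 $B=(-1,-1,1)$. An infinite word $x=x_1x_2\cdots$ over $\Sigma$ is $d$-legal if for every $m$: if $x_m=A$ then $x_{m-i}=a$ for all $1\le i\le d-1$ with $i<m$, and $x_{m-d}\in\{a,A\}$ if $m>d$; and the same holds with $\{a,A\}$ and $\{b,B\}$ interchanged. For $f\in\mathrm{Hom}(P_{\infty,d},0)$ let $L_\infty(f)$ be the infinite word over $\Sigma$ obtained from the increment sequence $(f(k)-f(k-1))_{k\ge1}$ by reading off letters of $\Sigma$ successively from left to right. Then $L_\infty$ is a bijection from $\mathrm{Hom}(P_{\infty,d},0)$ onto the set of infinite $d$-legal words, and its inverse sends $x$ to the function whose value at $k$ is the sum of the first $k$ entries of the $\pm1$ sequence obtained by concatenating $x_1,x_2,\dots$. (ii) *Chain.* There is a unique $\lambda>0$ with $\lambda^{d-1/2}(\lambda-2)=1$. Consider the Markov chain on the $2d+2$ states $a_1,\dots,a_d,b_1,\dots,b_d,A,B$ with initial distribution $\pi(a_d)=\pi(b_d)=\tfrac12\lambda^{-1/2}$, $\pi(A)=\pi(B)=\tfrac12(1-\lambda^{-1/2})$, and with the following transition probabilities, where $\beta_k=\frac{\lambda-1}{\lambda^k(\lambda-2)+\lambda}$: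 $p(a_k,b_1)=\beta_k$ for $1\le k\le d$; $p(a_k,a_{k+1})=1-\beta_k$ for $1\le k<d$; $p(a_d,a_d)=\lambda^{-1}$; $p(a_d,A)=1-\lambda^{-1}-\beta_d$; $p(A,b_1)=\lambda^{-1}$; if $d\ge2$, $p(A,a_2)=1-\lambda^{-1}$; if $d=1$, $p(A,a_1)=\lambda^{-1}$ and $p(A,A)=1-2\lambda^{-1}$; the same values hold with the roles of $a_k,A$ and $b_k,B$ interchanged; all other transition probabilities are $0$. Such a chain exists. (iii) *Limit.* For every such chain $\tilde W$, on any probability space, the infinite word $W_\infty$ over $\Sigma$ obtained by dropping the subscripts of the states is almost surely $d$-legal, and $L_\infty^{-1}(W_\infty)$ has law $\mu_{\infty,d}$. -/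

import Mathlib

open MeasureTheory ProbabilityTheory Filter Topology

namespace LocalLimit

/-- `Hom(G, v₀)`: the maps `f : V(G) → ℤ` with `f v₀ = 0` that send adjacent vertices to adjacent
integers. -/
def ZHom {V : Type*} (G : SimpleGraph V) (v₀ : V) : Set (V → ℤ) :=
  {f | f v₀ = 0 ∧ ∀ x y, G.Adj x y → |f x - f y| = 1}

/-- The graph `P_{n,d}` on `{0, …, n}`: `i` and `j` are adjacent iff `|i - j| ∈ {1, 3, …, 2d+1}`. -/
def lineGraph (n d : ℕ) : SimpleGraph (Fin (n + 1)) where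
  Adj i j := ∃ k ≤ d, |(i : ℤ) - (j : ℤ)| = 2 * (k : ℤ) + 1
  symm := ⟨by
    rintro i j ⟨k, hk, h⟩
    exact ⟨k, hk, by rw [abs_sub_comm]; exact h⟩⟩
  loopless := ⟨by
    rintro i ⟨k, -, h⟩
    rw [sub_self, abs_zero] at h
    omega⟩

/-- The graph `P_{∞,d}` on `{0, 1, 2, …}`: `i` and `j` are adjacent iff
`|i - j| ∈ {1, 3, …, 2d+1}`. -/
def halfLineGraph (d : ℕ) : SimpleGraph ℕ where
  Adj i j := ∃ k ≤ d, |(i : ℤ) - (j : ℤ)| = 2 * (k : ℤ) + 1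
  symm := ⟨by
    rintro i j ⟨k, hk, h⟩
    exact ⟨k, hk, by rw [abs_sub_comm]; exact h⟩⟩
  loopless := ⟨by
    rintro i ⟨k, -, h⟩
    rw [sub_self, abs_zero] at h
    omega⟩

/-- The uniform distribution on the finite set `Hom(P_{n,d}, 0)`. -/
noncomputable def uniformHom (n d : ℕ) : Measure (ZHom (lineGraph n d) 0) :=
  uniformOn Set.univ

/-- The event that `g ∈ Hom(P_{n,d}, 0)` restricted to `{0, …, r}` equals `f`
(meaningful for `r ≤ n`). -/
def finiteCylinder (n d r : ℕ) (f : Fin (r + 1) → ℤ) : Set (ZHom (lineGraph n d) 0) :=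
  {g | ∀ (i : Fin (n + 1)) (j : Fin (r + 1)), (i : ℕ) = (j : ℕ) → g.1 i = f j}

/-- The event that `g ∈ Hom(P_{∞,d}, 0)` restricted to `{0, …, r}` equals `f`. -/
def infiniteCylinder (d r : ℕ) (f : Fin (r + 1) → ℤ) : Set (ZHom (halfLineGraph d) 0) :=
  {g | ∀ j : Fin (r + 1), g.1 j = f j}

/-- The alphabet `Σ = {a, b, A, B}`. -/
inductive Letter
  | a | b | A | B

/-- The letters as words over `{-1, 1}`. -/
def Letter.steps : Letter → List ℤ
  | .a => [1, -1]
  | .b => [-1, 1]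
  | .A => [1, 1, -1]
  | .B => [-1, -1, 1]

/-- The `d`-legal infinite words on `Σ`. Positions are counted from `0`. -/
def legalWords (d : ℕ) : Set (ℕ → Letter) :=
  {x | ∀ m,
    (x m = .A → ∀ i, 1 ≤ i → i ≤ d - 1 → i ≤ m → x (m - i) = .a) ∧
    (x m = .B → ∀ i, 1 ≤ i → i ≤ d - 1 → i ≤ m → x (m - i) = .b) ∧
    (x m = .A → d ≤ m → x (m - d) = .a ∨ x (m - d) = .A) ∧
    (x m = .B → d ≤ m → x (m - d) = .b ∨ x (m - d) = .B)}

/-- The infinite `±1` sequence `x₀ ∘ x₁ ∘ x₂ ∘ ⋯` obtained by concatenating the letters of `x`.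
The first `m + 1` letters already have more than `m` entries, so the default `0` is never used. -/
def concatSteps (x : ℕ → Letter) (m : ℕ) : ℤ :=
  ((List.range (m + 1)).flatMap fun i => (x i).steps).getD m 0

/-- The walk started at `0` whose increments spell the infinite word `x`. -/
def decode (x : ℕ → Letter) (k : ℕ) : ℤ :=
  ∑ i ∈ Finset.range k, concatSteps x i

/-- The first letter read off an infinite `±1` sequence. -/
def firstLetter (s : ℕ → ℤ) : Letter :=
  if s 0 = 1 then (if s 1 = -1 then .a else .A) else (if s 1 = 1 then .b else .B)

/-- The map `T` on infinite `±1` sequences, which satisfies `T (u ∘ v) = (u) ∘ T v` for `u ∈ Σ`: read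
off the first letter, delete its steps, continue. -/
def readLetters : (ℕ → ℤ) → ℕ → Letter
  | s, 0 => firstLetter s
  | s, k + 1 => readLetters (fun i => s (i + (firstLetter s).steps.length)) k

/-- The encoding `L_∞ = T ∘ D_∞`, where `D_∞` takes the sequence of increments. -/
def encode (f : ℕ → ℤ) : ℕ → Letter :=
  readLetters fun k => f (k + 1) - f k

/-- `lam` is a positive solution of `lam ^ (d - 1/2) * (lam - 2) = 1`. -/
def IsRate (d : ℕ) (lam : ℝ) : Prop :=
  0 < lam ∧ lam ^ ((d : ℝ) - 1 / 2) * (lam - 2) = 1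

/-- The `2d + 2` states `a_1, …, a_d, b_1, …, b_d, A, B`; `a k` with `k : Fin d` is the state
`a_{k+1}`, and likewise for `b k`. -/
inductive State (d : ℕ)
  | a (k : Fin d)
  | b (k : Fin d)
  | A
  | B

instance (d : ℕ) : MeasurableSpace (State d) := ⊤

/-- The letter of a state (drop the subscript). -/
def State.letter {d : ℕ} : State d → Letter
  | .a _ => .a
  | .b _ => .b
  | .A => .A
  | .B => .B

/-- Interchange the roles of `{a, A}` and `{b, B}`. -/
def State.swap {d : ℕ} : State d → State d
  | .a k => .b k
  | .b k => .a k
  | .A => .B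
  | .B => .A

/-- `(lam - 1) / (lam ^ k * (lam - 2) + lam)`, the probability of moving from `a_k` to `b_1`. -/
noncomputable def turnProb (lam : ℝ) (k : ℕ) : ℝ :=
  (lam - 1) / (lam ^ k * (lam - 2) + lam)

/-- The transition probabilities out of the states `a_k` and `A`. -/
noncomputable def transA (d : ℕ) (lam : ℝ) : State d → State d → ℝ
  | .a k, .b j => if (j : ℕ) = 0 then turnProb lam (k + 1) else 0
  | .a k, .a j =>
      if (k : ℕ) + 1 < d then (if (j : ℕ) = k + 1 then 1 - turnProb lam (k + 1) else 0)
      else (if j = k then lam⁻¹ else 0)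
  | .a k, .A => if (k : ℕ) + 1 = d then 1 - lam⁻¹ - turnProb lam d else 0
  | .A, .b j => if (j : ℕ) = 0 then lam⁻¹ else 0
  | .A, .a j => if d = 1 then lam⁻¹ else (if (j : ℕ) = 1 then 1 - lam⁻¹ else 0)
  | .A, .A => if d = 1 then 1 - 2 * lam⁻¹ else 0
  | _, _ => 0

/-- The transition probabilities of the chain. -/
noncomputable def trans (d : ℕ) (lam : ℝ) : State d → State d → ℝ
  | .a k, t => transA d lam (.a k) t
  | .A, t => transA d lam .A t
  | .b k, t => transA d lam (.a k) t.swap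
  | .B, t => transA d lam .A t.swap

/-- The initial distribution of the chain. -/
noncomputable def initial (d : ℕ) (lam : ℝ) : State d → ℝ
  | .a k => if (k : ℕ) + 1 = d then (Real.sqrt lam)⁻¹ / 2 else 0
  | .b k => if (k : ℕ) + 1 = d then (Real.sqrt lam)⁻¹ / 2 else 0
  | .A => (1 - (Real.sqrt lam)⁻¹) / 2
  | .B => (1 - (Real.sqrt lam)⁻¹) / 2

/-- `W 0, W 1, …` is, under the probability measure `P`, a Markov chain with initial distribution
`π` and transition probabilities `p`. -/
structure IsMarkovChain {Ω S : Type*} [MeasurableSpace Ω] [MeasurableSpace S] (P : Measure Ω)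
    (W : ℕ → Ω → S) (π : S → ℝ) (p : S → S → ℝ) : Prop where
  prob : IsProbabilityMeasure P
  meas : ∀ k, Measurable (W k)
  law : ∀ (k : ℕ) (s : ℕ → S), P.real {ω | ∀ i ≤ k, W i ω = s i} =
    π (s 0) * ∏ i ∈ Finset.range k, p (s i) (s (i + 1))

/-- The infinite word on `Σ` spelled by a trajectory of the chain. -/
def word {Ω : Type*} {d : ℕ} (W : ℕ → Ω → State d) (ω : Ω) : ℕ → Letter :=
  fun k => (W k ω).letter

end LocalLimit

namespace LocalLimit

/-! The proof turns homomorphisms into trajectories of a finite automaton and then counts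
trajectories.

Since $|f(i+3)-f(i)|=1$, three successive increments are never equal, so the increments of $f$ parse
uniquely into letters. At a letter boundary $p$, writing `A` moves the walk to $f(p)+2$. This is
possible exactly when no earlier point at odd distance less than $2d$ from $p$ has value $f(p)-1$. A
counter bounded by $d$ (`runA`, and symmetrically `runB`) records how far back this obstruction
lies, and `A` may be written precisely when the counter equals $d$. Legality is therefore a
condition with finite memory, and legal words are the paths in a graph on the $2d+2$ states
(`bijOn_encode`, `letters_image_trajectories`).

Every homomorphism on $\{0,\dots,n\}$ extends to the half-line (`HomUpTo.exists_extension`), so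
$|\mathrm{Hom}(P_{n,d},0)|$ is the number `numWalks d d d n` of truncated walks of trajectories.
Once the first letters are fixed, having $l$ steps in all and ending in state $s$, the number of
continuations is that of $s$ with $n-l$ steps.

Put $z=\lambda^{-1/2}$. The equation for $\lambda$ is the condition for a positive function $h$ on
states with $h(s)=\sum_t z^{|t|}h(t)$, where $t$ runs over the admissible successors and $|t|$ is
the length of its letter. The chain is the Doob transform $p(s,t)=z^{|t|}h(t)/h(s)$ (`trans_eq`).
The rescaled counts $N_s(m)z^m/h(s)$ are then averaged by $p$ with delays $2$ and $3$. These delays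
are coprime, so the counts converge to one constant $c>0$ for all $s$
(`exists_tendsto_scaledWalks`). In the ratio of counts $c$ cancels, and what remains is the
telescoped product of transition probabilities (`tendsto_ncard_div`). -/

/-! ### Parsing and concatenation of words -/

theorem Letter.length_steps (l : Letter) : l.steps.length = 2 ∨ l.steps.length = 3 := by
  cases l <;> simp [Letter.steps]

/-- The number of steps in the first `m` letters of a word. -/
def prefixLength (x : ℕ → Letter) (m : ℕ) : ℕ := ∑ i ∈ Finset.range m, (x i).steps.length

theorem prefixLength_succ (x : ℕ → Letter) (m : ℕ) :
    prefixLength x (m + 1) = prefixLength x m + (x m).steps.length :=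
  Finset.sum_range_succ _ _

theorem prefixLength_succ' (x : ℕ → Letter) (m : ℕ) :
    prefixLength x (m + 1) = (x 0).steps.length + prefixLength (fun i => x (i + 1)) m := by
  rw [prefixLength, Finset.sum_range_succ', add_comm]; rfl

theorem two_mul_le_prefixLength (x : ℕ → Letter) (m : ℕ) : 2 * m ≤ prefixLength x m := by
  induction m with
  | zero => simp
  | succ m ih => rw [prefixLength_succ]; have := (x m).length_steps; omega

theorem prefixLength_congr {x y : ℕ → Letter} {m : ℕ} (h : ∀ i < m, x i = y i) :
    prefixLength x m = prefixLength y m :=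
  Finset.sum_congr rfl fun i hi => by rw [h i (Finset.mem_range.1 hi)]

theorem length_flatMap_steps (x : ℕ → Letter) (n : ℕ) :
    ((List.range n).flatMap fun i => (x i).steps).length = prefixLength x n := by
  induction n with
  | zero => simp [prefixLength]
  | succ n ih =>
    rw [List.range_succ, List.flatMap_append, List.length_append, ih,
      prefixLength_succ]
    simp

theorem getD_flatMap_steps {x : ℕ → Letter} {n i : ℕ} (k : ℕ) (h : i < prefixLength x n) :
    ((List.range (n + k)).flatMap fun i => (x i).steps).getD i 0 =
      ((List.range n).flatMap fun i => (x i).steps).getD i 0 := by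
  induction k with
  | zero => rfl
  | succ k ih =>
    rw [← ih, ← add_assoc, List.range_succ, List.flatMap_append, List.getD_append]
    rw [length_flatMap_steps]
    refine h.trans_le ?_
    exact Finset.sum_le_sum_of_subset (Finset.range_subset_range.2 (Nat.le_add_right _ _))

theorem concatSteps_eq_getD {x : ℕ → Letter} {n i : ℕ} (h : i < prefixLength x n) :
    concatSteps x i = ((List.range n).flatMap fun i => (x i).steps).getD i 0 := by
  have h' : i < prefixLength x (i + 1) := by
    have := two_mul_le_prefixLength x (i + 1)
    omega
  rw [concatSteps, ← getD_flatMap_steps n h', ← getD_flatMap_steps (i + 1) h, add_comm]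

theorem concatSteps_of_lt {x : ℕ → Letter} {i : ℕ} (h : i < (x 0).steps.length) :
    concatSteps x i = (x 0).steps.getD i 0 := by
  rw [concatSteps, List.range_succ_eq_map, List.flatMap_cons, List.getD_append _ _ _ _ h]

theorem concatSteps_add (x : ℕ → Letter) (i : ℕ) :
    concatSteps x ((x 0).steps.length + i) = concatSteps (fun j => x (j + 1)) i := by
  have hl := (x 0).length_steps
  have := two_mul_le_prefixLength (fun j => x (j + 1)) ((x 0).steps.length + i)
  rw [concatSteps, List.range_succ_eq_map, List.flatMap_cons,
    List.getD_append_right _ _ _ _ (by omega), Nat.add_sub_cancel_left,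
    concatSteps_eq_getD (n := (x 0).steps.length + i) (by omega), List.flatMap_map]

theorem concatSteps_prefixLength_add_of_lt {x : ℕ → Letter} {m i : ℕ} (h : i < (x m).steps.length) :
    concatSteps x (prefixLength x m + i) = (x m).steps.getD i 0 := by
  induction m generalizing x with
  | zero => simpa [prefixLength] using concatSteps_of_lt h
  | succ m ih =>
    rw [prefixLength_succ', add_assoc, concatSteps_add]
    exact ih (x := fun j => x (j + 1)) h

theorem concatSteps_prefixLength_add (x : ℕ → Letter) (m i : ℕ) :
    concatSteps x (prefixLength x m + i) = concatSteps (fun j => x (m + j)) i := by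
  induction m generalizing x with
  | zero => simp [prefixLength]
  | succ m ih =>
    rw [prefixLength_succ', add_assoc, concatSteps_add, ih]
    simp only [add_right_comm, add_assoc]

theorem decode_zero (x : ℕ → Letter) : decode x 0 = 0 := by simp [decode]

theorem decode_succ (x : ℕ → Letter) (k : ℕ) : decode x (k + 1) = decode x k + concatSteps x k :=
  Finset.sum_range_succ _ _

theorem decode_congr {x y : ℕ → Letter} {n k : ℕ} (h : ∀ j < n, x j = y j)
    (hk : k ≤ prefixLength x n) : decode x k = decode y k := by
  refine Finset.sum_congr rfl fun i hi => ?_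
  have hi' := (Finset.mem_range.1 hi).trans_le hk
  rw [concatSteps_eq_getD hi', concatSteps_eq_getD (hi'.trans_eq (prefixLength_congr h))]
  congr 1
  refine List.flatMap_congr fun j hj => ?_
  rw [h j (by simpa using hj)]

theorem decode_prefixLength_add (x : ℕ → Letter) (m i : ℕ) :
    decode x (prefixLength x m + i) =
      decode x (prefixLength x m) + decode (fun j => x (m + j)) i := by
  simp only [decode, Finset.sum_range_add, concatSteps_prefixLength_add]

theorem firstLetter_concatSteps (x : ℕ → Letter) : firstLetter (concatSteps x) = x 0 := by
  have h0 : concatSteps x 0 = (x 0).steps.getD 0 0 :=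
    concatSteps_of_lt (by have := (x 0).length_steps; omega)
  have h1 : concatSteps x 1 = (x 0).steps.getD 1 0 :=
    concatSteps_of_lt (by have := (x 0).length_steps; omega)
  rw [firstLetter, h0, h1]
  cases x 0 <;> simp [Letter.steps]

theorem readLetters_concatSteps (x : ℕ → Letter) : readLetters (concatSteps x) = x := by
  funext k
  induction k generalizing x with
  | zero => exact firstLetter_concatSteps x
  | succ k ih =>
    rw [readLetters, firstLetter_concatSteps]
    simp only [add_comm _ (x 0).steps.length, concatSteps_add]
    exact ih _

theorem encode_decode (x : ℕ → Letter) : encode (decode x) = x := by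
  simp only [encode, decode_succ, add_sub_cancel_left]
  exact readLetters_concatSteps x

/-- A letter has at most three entries and is recognized from its first two, so $3(r+1)$ entries
reveal $r+1$ letters. -/
theorem eq_of_concatSteps_eq {x y : ℕ → Letter} {r : ℕ}
    (h : ∀ i < 3 * (r + 1), concatSteps x i = concatSteps y i) : ∀ i ≤ r, x i = y i := by
  have h0 : x 0 = y 0 := by
    rw [← firstLetter_concatSteps x, ← firstLetter_concatSteps y, firstLetter, firstLetter,
      h 0 (by omega), h 1 (by omega)]
  induction r generalizing x y with
  | zero => intro i hi; obtain rfl : i = 0 := by omega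
            exact h0
  | succ r ih =>
    have hs : ∀ i < 3 * (r + 1), concatSteps (fun j => x (j + 1)) i =
        concatSteps (fun j => y (j + 1)) i := by
      intro i hi
      rw [← concatSteps_add, ← concatSteps_add, ← h0]
      exact h _ (by have := (x 0).length_steps; omega)
    have h1 : x 1 = y 1 := by
      have e1 := firstLetter_concatSteps (fun j => x (j + 1))
      have e2 := firstLetter_concatSteps (fun j => y (j + 1))
      rw [firstLetter, hs 0 (by omega), hs 1 (by omega), ← firstLetter, e2] at e1
      exact e1.symm
    intro i hi
    cases i with
    | zero => exact h0
    | succ i => exact ih hs h1 i (by omega)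

theorem eq_of_decode_eq {x y : ℕ → Letter} {r : ℕ}
    (h : ∀ i ≤ 3 * (r + 1), decode x i = decode y i) : ∀ i ≤ r, x i = y i := by
  refine eq_of_concatSteps_eq fun i hi => ?_
  have h1 := h i hi.le
  have h2 := h (i + 1) hi
  rw [decode_succ, decode_succ] at h2
  omega

/-- The third entry of `A` or `B` is never inspected by `firstLetter`. It is correct because `h3`
forces a reversal after two equal steps. -/
theorem concatSteps_readLetters {s : ℕ → ℤ} (h1 : ∀ i, s i = 1 ∨ s i = -1)
    (h3 : ∀ i, s i = s (i + 1) → s (i + 2) = -s i) : concatSteps (readLetters s) = s := by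
  funext i
  induction i using Nat.strong_induction_on generalizing s with
  | _ i ih =>
    by_cases hi : i < (firstLetter s).steps.length
    · rw [concatSteps_of_lt hi]
      change (firstLetter s).steps.getD i 0 = s i
      have a0 := h1 0
      have a1 := h1 1
      have a2 := h3 0
      have hi' : i < 3 := by have := (firstLetter s).length_steps; omega
      unfold firstLetter at hi ⊢
      rcases a0 with a0 | a0 <;> rcases a1 with a1 | a1 <;>
        simp [a0, a1, Letter.steps] at a2 hi ⊢ <;> interval_cases i <;> simp_all
    · obtain ⟨j, rfl⟩ := Nat.exists_eq_add_of_le (not_lt.1 hi)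
      have := ih j (by have := (firstLetter s).length_steps; omega)
        (s := fun i => s (i + (firstLetter s).steps.length)) (fun i => h1 _)
        (fun i hi => by
          have := h3 (i + (firstLetter s).steps.length)
          rw [show i + 2 + (firstLetter s).steps.length =
            i + (firstLetter s).steps.length + 2 by omega]
          exact this (by rw [hi]; congr 1; omega))
      have e := concatSteps_add (readLetters s) j
      change concatSteps _ ((firstLetter s).steps.length + j) =
        concatSteps (readLetters fun i => s (i + (firstLetter s).steps.length)) j at e
      rw [e, this, add_comm]

/-- Only the edges of length 1 and 3 matter for parsing: the first make the increments $\pm1$, the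
second exclude three equal ones. -/
theorem decode_encode {f : ℕ → ℤ} (h0 : f 0 = 0) (h1 : ∀ i, |f i - f (i + 1)| = 1)
    (h3 : ∀ i, |f i - f (i + 3)| = 1) : decode (encode f) = f := by
  have key : concatSteps (encode f) = fun k => f (k + 1) - f k := by
    refine concatSteps_readLetters (fun i => ?_) (fun i hi => ?_)
    · have := h1 i
      rw [abs_eq zero_le_one] at this
      omega
    · have a1 := h1 i
      have a2 := h1 (i + 1)
      have a3 := h1 (i + 2)
      have a4 := h3 i
      rw [abs_eq zero_le_one] at a1 a2 a3 a4
      have e1 : i + 1 + 1 = i + 2 := rfl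
      have e2 : i + 2 + 1 = i + 3 := rfl
      rw [e1] at hi a2
      rw [e2] at a3 ⊢
      omega
  funext k
  rw [decode, key, Finset.sum_range_sub, h0, sub_zero]

/-! ### Legality in terms of two counters -/

/-- The update of the counter that permits the letter `A` once it has reached `d`. -/
def nextA (d p : ℕ) : Letter → ℕ
  | .a => min (p + 1) d
  | .A => 1
  | .b => 0
  | .B => 0

/-- The update of the counter that permits the letter `B` once it has reached `d`. -/
def nextB (d p : ℕ) : Letter → ℕ
  | .b => min (p + 1) d
  | .B => 1
  | .a => 0
  | .A => 0

/-- The counter for `A` after the first `m` letters of `x`. -/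
def runA (d : ℕ) (x : ℕ → Letter) : ℕ → ℕ
  | 0 => d
  | m + 1 => nextA d (runA d x m) (x m)

/-- The counter for `B` after the first `m` letters of `x`. -/
def runB (d : ℕ) (x : ℕ → Letter) : ℕ → ℕ
  | 0 => d
  | m + 1 => nextB d (runB d x m) (x m)

variable {d : ℕ} {x : ℕ → Letter}

theorem runA_le (hd : 1 ≤ d) (m : ℕ) : runA d x m ≤ d := by
  cases m with
  | zero => exact le_rfl
  | succ m => rw [runA]; cases x m <;> simp [nextA, hd]

theorem runB_le (hd : 1 ≤ d) (m : ℕ) : runB d x m ≤ d := by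
  cases m with
  | zero => exact le_rfl
  | succ m => rw [runB]; cases x m <;> simp [nextB, hd]

/-- The counter measures the run of `a` ending at the current position, an initial `A` counting as
one. It starts at $d$, as if infinitely many letters `a` preceded the word, because legality imposes
nothing before the first letter. -/
theorem le_runA_iff {m j : ℕ} (hj : 1 ≤ j) (hjd : j ≤ d) :
    j ≤ runA d x m ↔ (∀ i, 1 ≤ i → i < j → i ≤ m → x (m - i) = .a) ∧
      (j ≤ m → x (m - j) = .a ∨ x (m - j) = .A) := by
  induction m generalizing j with
  | zero =>
    refine iff_of_true hjd ⟨fun i _ _ _ => ?_, fun _ => ?_⟩ <;> omega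
  | succ m ih =>
    have hsub : ∀ i, 1 ≤ i → m + 1 - i = m - (i - 1) := by omega
    rw [runA]
    constructor
    · intro h
      have hx : x m = .a ∨ (j = 1 ∧ x m = .A) := by
        revert h; cases x m <;> simp [nextA] <;> omega
      rcases hx with hx | ⟨rfl, hx⟩
      · rw [hx, nextA] at h
        rcases Nat.eq_or_lt_of_le hj with rfl | hj
        · exact ⟨fun i _ _ => by omega, fun _ => by simp [hx]⟩
        · obtain ⟨h1, h2⟩ := (ih (j := j - 1) (by omega) (by omega)).1 (by omega)
          refine ⟨fun i hi hij him => ?_, fun hjm => ?_⟩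
          · rw [hsub i hi]
            rcases Nat.eq_or_lt_of_le hi with rfl | hi
            · exact hx
            · exact h1 (i - 1) (by omega) (by omega) (by omega)
          · rw [hsub j (by omega)]
            exact h2 (by omega)
      · exact ⟨fun i _ _ => by omega, fun _ => by simp [hx]⟩
    · rintro ⟨h1, h2⟩
      rcases Nat.eq_or_lt_of_le hj with rfl | hj
      · rcases h2 (by omega) with hx | hx <;> rw [Nat.add_sub_cancel] at hx <;>
          simp [hx, nextA, hjd]
      · have hx : x m = .a := h1 1 le_rfl hj (by omega)
        rw [hx, nextA]
        have := (ih (j := j - 1) (by omega) (by omega)).2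
          ⟨fun i hi hij him => by
            have := h1 (i + 1) (by omega) (by omega) (by omega)
            rwa [hsub _ (by omega)] at this, fun hjm => by
            have := h2 (by omega)
            rwa [hsub _ (by omega)] at this⟩
        omega

theorem le_runB_iff {m j : ℕ} (hj : 1 ≤ j) (hjd : j ≤ d) :
    j ≤ runB d x m ↔ (∀ i, 1 ≤ i → i < j → i ≤ m → x (m - i) = .b) ∧
      (j ≤ m → x (m - j) = .b ∨ x (m - j) = .B) := by
  induction m generalizing j with
  | zero =>
    refine iff_of_true hjd ⟨fun i _ _ _ => ?_, fun _ => ?_⟩ <;> omega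
  | succ m ih =>
    have hsub : ∀ i, 1 ≤ i → m + 1 - i = m - (i - 1) := by omega
    rw [runB]
    constructor
    · intro h
      have hx : x m = .b ∨ (j = 1 ∧ x m = .B) := by
        revert h; cases x m <;> simp [nextB] <;> omega
      rcases hx with hx | ⟨rfl, hx⟩
      · rw [hx, nextB] at h
        rcases Nat.eq_or_lt_of_le hj with rfl | hj
        · exact ⟨fun i _ _ => by omega, fun _ => by simp [hx]⟩
        · obtain ⟨h1, h2⟩ := (ih (j := j - 1) (by omega) (by omega)).1 (by omega)
          refine ⟨fun i hi hij him => ?_, fun hjm => ?_⟩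
          · rw [hsub i hi]
            rcases Nat.eq_or_lt_of_le hi with rfl | hi
            · exact hx
            · exact h1 (i - 1) (by omega) (by omega) (by omega)
          · rw [hsub j (by omega)]
            exact h2 (by omega)
      · exact ⟨fun i _ _ => by omega, fun _ => by simp [hx]⟩
    · rintro ⟨h1, h2⟩
      rcases Nat.eq_or_lt_of_le hj with rfl | hj
      · rcases h2 (by omega) with hx | hx <;> rw [Nat.add_sub_cancel] at hx <;>
          simp [hx, nextB, hjd]
      · have hx : x m = .b := h1 1 le_rfl hj (by omega)
        rw [hx, nextB]
        have := (ih (j := j - 1) (by omega) (by omega)).2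
          ⟨fun i hi hij him => by
            have := h1 (i + 1) (by omega) (by omega) (by omega)
            rwa [hsub _ (by omega)] at this, fun hjm => by
            have := h2 (by omega)
            rwa [hsub _ (by omega)] at this⟩
        omega

theorem mem_legalWords_iff (hd : 1 ≤ d) :
    x ∈ legalWords d ↔ ∀ m, (x m = .A → runA d x m = d) ∧ (x m = .B → runB d x m = d) := by
  have hA : ∀ m, runA d x m = d ↔ _ := fun m =>
    (⟨fun h => h.ge, fun h => (runA_le hd m).antisymm h⟩ : runA d x m = d ↔ d ≤ runA d x m).trans
      (le_runA_iff hd le_rfl)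
  have hB : ∀ m, runB d x m = d ↔ _ := fun m =>
    (⟨fun h => h.ge, fun h => (runB_le hd m).antisymm h⟩ : runB d x m = d ↔ d ≤ runB d x m).trans
      (le_runB_iff hd le_rfl)
  have hlt : ∀ i, i ≤ d - 1 ↔ i < d := by omega
  simp only [legalWords, Set.mem_ofPred_eq, hA, hB, hlt]
  exact forall_congr' fun m => by tauto

/-! ### Legal words and homomorphisms -/

theorem decode_prefixLength_add_one (x : ℕ → Letter) (m : ℕ) :
    decode x (prefixLength x m + 1) = decode x (prefixLength x m) + (x m).steps.getD 0 0 := by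
  rw [decode_succ, ← concatSteps_prefixLength_add_of_lt (i := 0)
    (by cases x m <;> simp [Letter.steps])]
  rfl

theorem decode_prefixLength_add_two (x : ℕ → Letter) (m : ℕ) :
    decode x (prefixLength x m + 2) =
      decode x (prefixLength x m) + (x m).steps.getD 0 0 + (x m).steps.getD 1 0 := by
  rw [decode_succ, decode_prefixLength_add_one,
    ← concatSteps_prefixLength_add_of_lt (i := 1) (by cases x m <;> simp [Letter.steps])]

theorem decode_prefixLength_add_three {m : ℕ} (h : 2 < (x m).steps.length) :
    decode x (prefixLength x m + 3) = decode x (prefixLength x m) +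
      (x m).steps.getD 0 0 + (x m).steps.getD 1 0 + (x m).steps.getD 2 0 := by
  rw [decode_succ, decode_prefixLength_add_two, ← concatSteps_prefixLength_add_of_lt h]

theorem decode_of_eq_a {m : ℕ} (h : x m = .a) :
    prefixLength x (m + 1) = prefixLength x m + 2 ∧
    decode x (prefixLength x m + 1) = decode x (prefixLength x m) + 1 ∧
    decode x (prefixLength x m + 2) = decode x (prefixLength x m) := by
  rw [prefixLength_succ, decode_prefixLength_add_one, decode_prefixLength_add_two, h]
  simp [Letter.steps]

theorem decode_of_eq_b {m : ℕ} (h : x m = .b) :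
    prefixLength x (m + 1) = prefixLength x m + 2 ∧
    decode x (prefixLength x m + 1) = decode x (prefixLength x m) - 1 ∧
    decode x (prefixLength x m + 2) = decode x (prefixLength x m) := by
  rw [prefixLength_succ, decode_prefixLength_add_one, decode_prefixLength_add_two, h]
  simp [Letter.steps, sub_eq_add_neg]

theorem decode_of_eq_A {m : ℕ} (h : x m = .A) :
    prefixLength x (m + 1) = prefixLength x m + 3 ∧
    decode x (prefixLength x m + 1) = decode x (prefixLength x m) + 1 ∧
    decode x (prefixLength x m + 2) = decode x (prefixLength x m) + 2 ∧
    decode x (prefixLength x m + 3) = decode x (prefixLength x m) + 1 := by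
  rw [prefixLength_succ, decode_prefixLength_add_one, decode_prefixLength_add_two,
    decode_prefixLength_add_three (by rw [h]; simp [Letter.steps]), h]
  refine ⟨rfl, rfl, ?_, ?_⟩ <;> simp [Letter.steps] <;> ring

theorem decode_of_eq_B {m : ℕ} (h : x m = .B) :
    prefixLength x (m + 1) = prefixLength x m + 3 ∧
    decode x (prefixLength x m + 1) = decode x (prefixLength x m) - 1 ∧
    decode x (prefixLength x m + 2) = decode x (prefixLength x m) - 2 ∧
    decode x (prefixLength x m + 3) = decode x (prefixLength x m) - 1 := by
  rw [prefixLength_succ, decode_prefixLength_add_one, decode_prefixLength_add_two,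
    decode_prefixLength_add_three (by rw [h]; simp [Letter.steps]), h]
  refine ⟨rfl, rfl, ?_, ?_⟩ <;> simp [Letter.steps] <;> ring

/-- This is the geometric meaning of the counter. The letters `b`, `B` create a lower point at
distance 1 before their end, and `A` has one at distance 3, its start. Each further `a` returns to
the same height and increases the distance by 2. -/
theorem decode_sub_of_runA_lt (m : ℕ) (h : runA d x m < d) :
    ∃ t, t + (2 * runA d x m + 1) = prefixLength x m ∧
      decode x t = decode x (prefixLength x m) - 1 := by
  induction m with
  | zero => exact absurd h (lt_irrefl _)
  | succ m ih =>
    rw [runA] at h ⊢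
    cases hx : x m with
    | a =>
      obtain ⟨e1, e2, e3⟩ := decode_of_eq_a hx
      rw [hx, nextA] at h
      obtain ⟨t, ht, ht'⟩ := ih (by omega)
      refine ⟨t, ?_, ?_⟩
      · rw [e1, nextA]; omega
      · rw [e1, e3, ht']
    | b =>
      obtain ⟨e1, e2, e3⟩ := decode_of_eq_b hx
      exact ⟨prefixLength x m + 1, by rw [e1, nextA], by rw [e1, e3, e2]⟩
    | A =>
      obtain ⟨e1, e2, e3, e4⟩ := decode_of_eq_A hx
      exact ⟨prefixLength x m, by rw [e1, nextA], by rw [e1, e4]; ring⟩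
    | B =>
      obtain ⟨e1, e2, e3, e4⟩ := decode_of_eq_B hx
      exact ⟨prefixLength x m + 2, by rw [e1, nextA], by rw [e1, e4, e3]; ring⟩

theorem decode_add_of_runB_lt (m : ℕ) (h : runB d x m < d) :
    ∃ t, t + (2 * runB d x m + 1) = prefixLength x m ∧
      decode x t = decode x (prefixLength x m) + 1 := by
  induction m with
  | zero => exact absurd h (lt_irrefl _)
  | succ m ih =>
    rw [runB] at h ⊢
    cases hx : x m with
    | b =>
      obtain ⟨e1, e2, e3⟩ := decode_of_eq_b hx
      rw [hx, nextB] at h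
      obtain ⟨t, ht, ht'⟩ := ih (by omega)
      refine ⟨t, ?_, ?_⟩
      · rw [e1, nextB]; omega
      · rw [e1, e3, ht']
    | a =>
      obtain ⟨e1, e2, e3⟩ := decode_of_eq_a hx
      exact ⟨prefixLength x m + 1, by rw [e1, nextB], by rw [e1, e3, e2]⟩
    | B =>
      obtain ⟨e1, e2, e3, e4⟩ := decode_of_eq_B hx
      exact ⟨prefixLength x m, by rw [e1, nextB], by rw [e1, e4]; ring⟩
    | A =>
      obtain ⟨e1, e2, e3, e4⟩ := decode_of_eq_A hx
      exact ⟨prefixLength x m + 2, by rw [e1, nextB], by rw [e1, e4, e3]; ring⟩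

/-- `f` satisfies the constraints of `Hom(P_{∞,d}, 0)` between points of `{0, …, n}`. -/
def HomUpTo (d : ℕ) (f : ℕ → ℤ) (n : ℕ) : Prop :=
  ∀ s k, k ≤ d → s + (2 * k + 1) ≤ n →
    f (s + (2 * k + 1)) = f s + 1 ∨ f (s + (2 * k + 1)) = f s - 1

theorem abs_sub_eq_one_iff {a b : ℤ} : |a - b| = 1 ↔ b = a + 1 ∨ b = a - 1 := by
  rw [abs_eq zero_le_one]; omega

theorem mem_ZHom_halfLineGraph_iff {f : ℕ → ℤ} :
    f ∈ ZHom (halfLineGraph d) 0 ↔ f 0 = 0 ∧ ∀ n, HomUpTo d f n := by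
  refine and_congr_right fun _ => ⟨fun h n s k hk _ => ?_, fun h s t hst => ?_⟩
  · exact abs_sub_eq_one_iff.1 (h _ _ ⟨k, hk, by push_cast; rw [abs_sub_comm]; simp; positivity⟩)
  · obtain ⟨k, hk, hst⟩ := hst
    rw [abs_eq (by positivity)] at hst
    rcases hst with hst | hst
    · obtain rfl : s = t + (2 * k + 1) := by omega
      rw [abs_sub_comm]
      exact abs_sub_eq_one_iff.2 (h _ t k hk le_rfl)
    · obtain rfl : t = s + (2 * k + 1) := by omega
      exact abs_sub_eq_one_iff.2 (h _ s k hk le_rfl)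

theorem mem_ZHom_lineGraph_iff {n : ℕ} {f : ℕ → ℤ} :
    (fun i : Fin (n + 1) => f i) ∈ ZHom (lineGraph n d) 0 ↔ f 0 = 0 ∧ HomUpTo d f n := by
  refine and_congr (by simp) ⟨fun h s k hk hn => ?_, fun h s t hst => ?_⟩
  · exact abs_sub_eq_one_iff.1 (h ⟨s, by omega⟩ ⟨s + (2 * k + 1), by omega⟩
      ⟨k, hk, by push_cast; rw [abs_sub_comm]; simp; positivity⟩)
  · obtain ⟨k, hk, hst⟩ := hst
    rw [abs_eq (by positivity)] at hst
    have hs := s.2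
    have ht := t.2
    rcases hst with hst | hst
    · have e : (s : ℕ) = t + (2 * k + 1) := by omega
      rw [abs_sub_comm]
      have := h t k hk (by omega)
      rw [← e] at this
      exact abs_sub_eq_one_iff.2 this
    · have e : (t : ℕ) = s + (2 * k + 1) := by omega
      have := h s k hk (by omega)
      rw [← e] at this
      exact abs_sub_eq_one_iff.2 this

theorem mem_legalWords_of_decode_mem (hd : 1 ≤ d)
    (h : decode x ∈ ZHom (halfLineGraph d) 0) : x ∈ legalWords d := by
  obtain ⟨-, h⟩ := mem_ZHom_halfLineGraph_iff.1 h
  refine (mem_legalWords_iff hd).2 fun m => ⟨fun hx => ?_, fun hx => ?_⟩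
  · by_contra hne
    have hlt := lt_of_le_of_ne (runA_le hd m) hne
    obtain ⟨t, ht, ht'⟩ := decode_sub_of_runA_lt m hlt
    obtain ⟨-, -, e, -⟩ := decode_of_eq_A hx
    -- The middle of `A` would be 3 above `t`, although the two points are adjacent: their distance
    -- is $2(\mathrm{runA}+1)+1\le 2d+1$.
    have := h _ t (runA d x m + 1) hlt le_rfl
    rw [show t + (2 * (runA d x m + 1) + 1) = prefixLength x m + 2 by omega] at this
    omega
  · by_contra hne
    have hlt := lt_of_le_of_ne (runB_le hd m) hne
    obtain ⟨t, ht, ht'⟩ := decode_add_of_runB_lt m hlt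
    obtain ⟨-, -, e, -⟩ := decode_of_eq_B hx
    have := h _ t (runB d x m + 1) hlt le_rfl
    rw [show t + (2 * (runB d x m + 1) + 1) = prefixLength x m + 2 by omega] at this
    omega

/-- The values of a walk at the points before a letter boundary `p`, in terms of the counters. -/
structure BoundaryInvariant (d : ℕ) (f : ℕ → ℤ) (p u v : ℕ) : Prop where
  hom : HomUpTo d f p
  even : ∀ t k, k ≤ d → t + 2 * k = p → f t = f p
  upper : ∀ t k, k < u → t + (2 * k + 1) = p → f t = f p + 1
  lower : ∀ t k, k < v → t + (2 * k + 1) = p → f t = f p - 1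

theorem HomUpTo.succ {f : ℕ → ℤ} {n : ℕ} (h : HomUpTo d f n)
    (h' : ∀ t k, k ≤ d → t + 2 * k = n → f (n + 1) = f t + 1 ∨ f (n + 1) = f t - 1) :
    HomUpTo d f (n + 1) := by
  intro s k hk hn
  rcases Nat.eq_or_lt_of_le hn with hn | hn
  · rw [hn]; exact h' s k hk (by omega)
  · exact h s k hk (by omega)

theorem BoundaryInvariant.neg {f : ℕ → ℤ} {p u v : ℕ} (h : BoundaryInvariant d f p u v) :
    BoundaryInvariant d (-f) p v u where
  hom s k hk hn := by have := h.hom s k hk hn; simp only [Pi.neg_apply]; omega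
  even t k hk ht := by have := h.even t k hk ht; simp only [Pi.neg_apply]; omega
  upper t k hk ht := by have := h.lower t k hk ht; simp only [Pi.neg_apply]; omega
  lower t k hk ht := by have := h.upper t k hk ht; simp only [Pi.neg_apply]; omega

theorem BoundaryInvariant.short {f : ℕ → ℤ} {p u v : ℕ} (h : BoundaryInvariant d f p u v)
    (e1 : f (p + 1) = f p + 1) (e2 : f (p + 2) = f p) :
    BoundaryInvariant d f (p + 2) (min (u + 1) d) 0 where
  hom := by
    refine (h.hom.succ fun t k hk ht => ?_).succ fun t k hk ht => ?_
    · rw [h.even t k hk ht]; omega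
    · rcases k with - | k
      · obtain rfl : t = p + 1 := by omega
        change f (p + 2) = _ ∨ f (p + 2) = _
        omega
      · have := h.hom t k (by omega) (by omega)
        rw [show t + (2 * k + 1) = p by omega] at this
        change f (p + 2) = _ ∨ f (p + 2) = _
        omega
  even t k hk ht := by
    rcases k with - | k
    · rw [← ht]; rfl
    · rw [h.even t k (by omega) (by omega), e2]
  upper t k hk ht := by
    rcases k with - | k
    · obtain rfl : t = p + 1 := by omega
      rw [e1, e2]
    · rw [h.upper t k (by omega) (by omega), e2]
  lower t k hk ht := by omega

/-- With the upper counter equal to $d$, every earlier neighbour of `p + 2` other than `p + 1` has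
value `f p + 1`, so the rise to `f p + 2` is allowed. The start `p` lies one below the new boundary
at distance 3, which limits the new upper counter to 1. -/
theorem BoundaryInvariant.long {f : ℕ → ℤ} {p v : ℕ} (h : BoundaryInvariant d f p d v)
    (e1 : f (p + 1) = f p + 1) (e2 : f (p + 2) = f p + 2) (e3 : f (p + 3) = f p + 1) :
    BoundaryInvariant d f (p + 3) 1 0 where
  hom := by
    refine ((h.hom.succ fun t k hk ht => ?_).succ fun t k hk ht => ?_).succ fun t k hk ht => ?_
    · rw [h.even t k hk ht]; omega
    · change f (p + 2) = _ ∨ f (p + 2) = _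
      rcases k with - | k
      · obtain rfl : t = p + 1 := by omega
        omega
      · rw [h.upper t k (by omega) (by omega)]
        omega
    · change f (p + 3) = _ ∨ f (p + 3) = _
      rcases k with - | k
      · obtain rfl : t = p + 2 := by omega
        omega
      · rw [h.even t k (by omega) (by omega)]
        omega
  even t k hk ht := by
    rcases k with - | - | k
    · rw [← ht]; rfl
    · obtain rfl : t = p + 1 := by omega
      omega
    · rw [h.upper t k (by omega) (by omega), e3]
  upper t k hk ht := by
    obtain rfl : t = p + 2 := by omega
    omega
  lower t k hk ht := by omega

theorem boundaryInvariant_decode (hx : ∀ m, (x m = .A → runA d x m = d) ∧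
    (x m = .B → runB d x m = d)) (m : ℕ) :
    BoundaryInvariant d (decode x) (prefixLength x m) (runA d x m) (runB d x m) := by
  induction m with
  | zero =>
    have : prefixLength x 0 = 0 := rfl
    refine ⟨fun s k _ _ => ?_, fun t k _ _ => ?_, fun t k _ _ => ?_, fun t k _ _ => ?_⟩ <;>
      first | omega | (congr 1; omega)
  | succ m ih =>
    rw [runA, runB]
    cases h : x m with
    | a =>
      obtain ⟨e1, e2, e3⟩ := decode_of_eq_a h
      rw [e1]
      exact ih.short e2 e3
    | b =>
      obtain ⟨e1, e2, e3⟩ := decode_of_eq_b h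
      rw [e1]
      -- Negating the walk exchanges the two counters and turns `b` into `a`.
      have := (ih.neg.short (by simp only [Pi.neg_apply]; omega)
        (by simp only [Pi.neg_apply]; omega)).neg
      rwa [neg_neg] at this
    | A =>
      obtain ⟨e1, e2, e3, e4⟩ := decode_of_eq_A h
      rw [(hx m).1 h] at ih
      rw [e1]
      exact ih.long e2 e3 e4
    | B =>
      obtain ⟨e1, e2, e3, e4⟩ := decode_of_eq_B h
      rw [(hx m).2 h] at ih
      rw [e1]
      have := (ih.neg.long (by simp only [Pi.neg_apply]; omega) (by simp only [Pi.neg_apply]; omega)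
        (by simp only [Pi.neg_apply]; omega)).neg
      rwa [neg_neg] at this

theorem decode_mem_of_mem_legalWords (hd : 1 ≤ d) (h : x ∈ legalWords d) :
    decode x ∈ ZHom (halfLineGraph d) 0 := by
  refine mem_ZHom_halfLineGraph_iff.2 ⟨decode_zero x, fun n s k hk hn => ?_⟩
  refine (boundaryInvariant_decode ((mem_legalWords_iff hd).1 h) n).hom s k hk (hn.trans ?_)
  have := two_mul_le_prefixLength x n
  omega

theorem decode_encode_of_mem {f : ℕ → ℤ} (hd : 1 ≤ d) (h : f ∈ ZHom (halfLineGraph d) 0) :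
    decode (encode f) = f :=
  decode_encode h.1 (fun i => h.2 _ _ ⟨0, by omega, by simp⟩)
    (fun i => h.2 _ _ ⟨1, hd, by simp⟩)

theorem invOn_decode_encode (hd : 1 ≤ d) :
    Set.InvOn decode encode (ZHom (halfLineGraph d) 0) (legalWords d) :=
  ⟨fun _ hf => decode_encode_of_mem hd hf, fun x _ => encode_decode x⟩

theorem bijOn_encode (hd : 1 ≤ d) :
    Set.BijOn encode (ZHom (halfLineGraph d) 0) (legalWords d) :=
  (invOn_decode_encode hd).bijOn
    (fun _ hf => mem_legalWords_of_decode_mem hd (by rwa [decode_encode_of_mem hd hf]))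
    (fun _ hx => decode_mem_of_mem_legalWords hd hx)

/-! ### Extension of finite homomorphisms -/

/-- Two points of the window at even distance at most $2d$ differ in value by at most 2, through a
path of two edges. The values in the window thus avoid either `f n - 2` or `f n + 2`, and one of `f
n + 1`, `f n - 1` is adjacent to all of them. -/
theorem HomUpTo.exists_next {d n : ℕ} {f : ℕ → ℤ} (h : HomUpTo d f n) :
    ∃ v, ∀ t k, k ≤ d → t + 2 * k = n → v = f t + 1 ∨ v = f t - 1 := by
  have near : ∀ t k, k ≤ d → t + 2 * k = n → f t = f n - 2 ∨ f t = f n ∨ f t = f n + 2 := by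
    intro t k hk ht
    rcases k with - | k
    · simp [← ht]
    · have h1 := h t 0 (by omega) (by omega)
      have h2 := h (t + 1) k (by omega) (by omega)
      rw [show t + 1 + (2 * k + 1) = n by omega] at h2
      rw [show t + (2 * 0 + 1) = t + 1 by omega] at h1
      omega
  by_cases hlow : ∃ t k, k ≤ d ∧ t + 2 * k = n ∧ f t = f n - 2
  · obtain ⟨t, k, hk, ht, hft⟩ := hlow
    refine ⟨f n - 1, fun t' k' hk' ht' => ?_⟩
    have hne : f t' ≠ f n + 2 := by
      intro hft'
      rcases lt_trichotomy t t' with hlt | rfl | hlt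
      · have h1 := h t 0 (by omega) (by omega)
        have h2 := h (t + 1) (k - k' - 1) (by omega) (by omega)
        rw [show t + 1 + (2 * (k - k' - 1) + 1) = t' by omega] at h2
        rw [show t + (2 * 0 + 1) = t + 1 by omega] at h1
        omega
      · omega
      · have h1 := h t' 0 (by omega) (by omega)
        have h2 := h (t' + 1) (k' - k - 1) (by omega) (by omega)
        rw [show t' + 1 + (2 * (k' - k - 1) + 1) = t by omega] at h2
        rw [show t' + (2 * 0 + 1) = t' + 1 by omega] at h1
        omega
    have := near t' k' hk' ht'
    omega
  · refine ⟨f n + 1, fun t k hk ht => ?_⟩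
    have h1 := near t k hk ht
    have h2 : f t ≠ f n - 2 := fun e => hlow ⟨t, k, hk, ht, e⟩
    omega

theorem HomUpTo.exists_extension {d n : ℕ} {f : ℕ → ℤ} (h0 : f 0 = 0) (h : HomUpTo d f n) :
    ∃ f' ∈ ZHom (halfLineGraph d) 0, ∀ i ≤ n, f' i = f i := by
  obtain ⟨v, hv⟩ := h.exists_next
  have hvn := hv n 0 (by omega) (by omega)
  -- After time `n` the extension alternates between `v` and `f n`. A late point and an early one
  -- are then compared as if the late point were `n` or `n + 1`, according to parity, which only
  -- shortens their distance.
  let f' : ℕ → ℤ := fun t => if t ≤ n then f t else if (t - n) % 2 = 0 then f n else v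
  have e1 : ∀ t, t ≤ n → f' t = f t := fun t ht => if_pos ht
  have e2 : ∀ t, n ≤ t → (t - n) % 2 = 0 → f' t = f n := by
    intro t ht ht'
    rcases ht.eq_or_lt with rfl | hlt
    · exact e1 _ le_rfl
    · simp only [f', if_neg (not_le.2 hlt), if_pos ht']
  have e3 : ∀ t, n ≤ t → (t - n) % 2 = 1 → f' t = v := by
    intro t ht ht'
    have hlt : ¬ t ≤ n := by intro h; omega
    simp only [f', if_neg hlt, ht', one_ne_zero, if_false]
  refine ⟨f', mem_ZHom_halfLineGraph_iff.2 ⟨by rw [e1 _ (Nat.zero_le _), h0], ?_⟩, e1⟩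
  intro N s k hk _
  rcases le_or_gt (s + (2 * k + 1)) n with ht | ht
  · rw [e1 _ ht, e1 _ (by omega)]; exact h s k hk ht
  rcases le_or_gt n s with hs | hs
  · rcases Nat.mod_two_eq_zero_or_one (s - n) with hp | hp
    · rw [e2 s hs hp, e3 _ ht.le (by omega)]; omega
    · rw [e3 s hs hp, e2 _ ht.le (by omega)]; omega
  · rw [e1 s hs.le]
    rcases Nat.mod_two_eq_zero_or_one (s + (2 * k + 1) - n) with hp | hp
    · rw [e2 _ ht.le hp]
      have := h s ((n - s - 1) / 2) (by omega) (by omega)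
      rwa [show s + (2 * ((n - s - 1) / 2) + 1) = n by omega] at this
    · rw [e3 _ ht.le hp]
      exact hv s ((n - s) / 2) (by omega) (by omega)

/-! ### States and trajectories -/

/-- The sum decomposition of the set of states. -/
def State.equivSum (d : ℕ) : State d ≃ Fin d ⊕ Fin d ⊕ Bool where
  toFun
    | .a k => .inl k
    | .b k => .inr (.inl k)
    | .A => .inr (.inr true)
    | .B => .inr (.inr false)
  invFun
    | .inl k => .a k
    | .inr (.inl k) => .b k
    | .inr (.inr true) => .A
    | .inr (.inr false) => .B
  left_inv s := by cases s <;> rfl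
  right_inv s := by rcases s with _ | _ | _ | _ <;> rfl

instance : Fintype (State d) := Fintype.ofEquiv _ (State.equivSum d).symm

theorem State.sum_eq (f : State d → ℝ) :
    ∑ t, f t = ∑ k, f (.a k) + ∑ k, f (.b k) + f .A + f .B := by
  rw [← (State.equivSum d).symm.sum_comp]
  simp [State.equivSum, add_assoc]

instance : DiscreteMeasurableSpace (State d) := ⟨fun _ => trivial⟩

/-- The number of letters, up to the last obstruction to the letter `A` (at most `d`). -/
def State.countA : State d → ℕ
  | .a k => k + 1
  | .A => 1
  | .b _ => 0
  | .B => 0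

/-- The number of letters, up to the last obstruction to the letter `B` (at most `d`). -/
def State.countB : State d → ℕ
  | .b k => k + 1
  | .B => 1
  | .a _ => 0
  | .A => 0

/-- The states that may be entered when the counters for `A` and `B` are `p` and `q`. -/
def Permitted (p q : ℕ) : State d → Prop
  | .a k => (k : ℕ) + 1 = min (p + 1) d
  | .b k => (k : ℕ) + 1 = min (q + 1) d
  | .A => p = d
  | .B => q = d

/-- The transitions of positive probability. -/
def Admissible (s t : State d) : Prop := Permitted s.countA s.countB t

theorem Permitted.countA_eq {p q : ℕ} {t : State d} (h : Permitted p q t) :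
    t.countA = nextA d p t.letter := by
  cases t <;> simp_all [Permitted, State.countA, State.letter, nextA]

theorem Permitted.countB_eq {p q : ℕ} {t : State d} (h : Permitted p q t) :
    t.countB = nextB d q t.letter := by
  cases t <;> simp_all [Permitted, State.countB, State.letter, nextB]

theorem Permitted.eq_of_letter_eq {p q : ℕ} {s t : State d} (hs : Permitted p q s)
    (ht : Permitted p q t) (h : s.letter = t.letter) : s = t := by
  cases s <;> cases t <;> simp_all [Permitted, State.letter] <;> exact Fin.ext (by omega)

/-- The state entered by reading a letter when the counters are `p` and `q`. -/
def stateOf (hd : 1 ≤ d) (p q : ℕ) : Letter → State d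
  | .a => .a ⟨min (p + 1) d - 1, by omega⟩
  | .b => .b ⟨min (q + 1) d - 1, by omega⟩
  | .A => .A
  | .B => .B

theorem letter_stateOf (hd : 1 ≤ d) (p q : ℕ) (l : Letter) : (stateOf hd p q l).letter = l := by
  cases l <;> rfl

theorem permitted_stateOf (hd : 1 ≤ d) {p q : ℕ} {l : Letter}
    (h : (l = .A → p = d) ∧ (l = .B → q = d)) : Permitted p q (stateOf hd p q l) := by
  cases l with
  | a => simp only [stateOf, Permitted]; omega
  | b => simp only [stateOf, Permitted]; omega
  | A => exact h.1 rfl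
  | B => exact h.2 rfl

/-- The trajectories all of whose transitions are admissible, starting from counters `p`, `q`. -/
def trajectories (d p q : ℕ) : Set (ℕ → State d) :=
  {t | Permitted p q (t 0) ∧ ∀ i, Admissible (t i) (t (i + 1))}

/-- The letters of a trajectory. -/
def letters (t : ℕ → State d) : ℕ → Letter := fun i => (t i).letter

/-- The walk spelled by a trajectory. -/
def walk (t : ℕ → State d) : ℕ → ℤ := decode (letters t)

/-- A state stores both counters, so along a trajectory the counters read from the states are those
run on the letters. -/
theorem run_letters {t : ℕ → State d} (ht : t ∈ trajectories d d d) (m : ℕ) :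
    Permitted (runA d (letters t) m) (runB d (letters t) m) (t m) := by
  induction m with
  | zero => exact ht.1
  | succ m ih =>
    have := ht.2 m
    rw [Admissible, ih.countA_eq, ih.countB_eq] at this
    exact this

/-- Conversely, the subscripts of the states spelling a legal word are recovered from the counters
before each letter. -/
theorem letters_image_trajectories (hd : 1 ≤ d) :
    letters '' trajectories d d d = legalWords d := by
  ext x
  rw [mem_legalWords_iff hd]
  constructor
  · rintro ⟨t, ht, rfl⟩ m
    have := run_letters ht m
    constructor <;> intro h <;> change (t m).letter = _ at h <;> revert this h <;>
      generalize t m = s <;> cases s <;> simp [State.letter, Permitted]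
  · intro hx
    let t : ℕ → State d := fun m => stateOf hd (runA d x m) (runB d x m) (x m)
    have hp : ∀ m, Permitted (runA d x m) (runB d x m) (t m) := fun m => permitted_stateOf hd (hx m)
    refine ⟨t, ⟨hp 0, fun m => ?_⟩, funext fun m => letter_stateOf hd _ _ _⟩
    have := hp (m + 1)
    rw [Admissible, (hp m).countA_eq, (hp m).countB_eq, letter_stateOf]
    exact this

theorem walk_image_trajectories (hd : 1 ≤ d) :
    walk '' trajectories d d d = ZHom (halfLineGraph d) 0 := by
  rw [show (walk : (ℕ → State d) → ℕ → ℤ) = decode ∘ letters from rfl, Set.image_comp,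
    letters_image_trajectories hd, ← (bijOn_encode hd).image_eq, Set.image_image]
  exact (Set.image_congr fun f hf => decode_encode_of_mem hd hf).trans (Set.image_id' _)

theorem eq_of_letters_eq {p q r : ℕ} {s t : ℕ → State d} (hs : s ∈ trajectories d p q)
    (ht : t ∈ trajectories d p q) (h : ∀ i ≤ r, letters s i = letters t i) :
    ∀ i ≤ r, s i = t i := by
  intro i
  induction i with
  | zero => exact fun hi => hs.1.eq_of_letter_eq ht.1 (h 0 hi)
  | succ i ih =>
    intro hi
    have e := ih (by omega)
    have h1 := hs.2 i
    rw [e] at h1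
    exact h1.eq_of_letter_eq (ht.2 i) (h _ hi)

/-- The letter `a` is permitted by every pair of counters, so it can be written forever. -/
theorem trajectories_nonempty (hd : 1 ≤ d) (p q : ℕ) : (trajectories d p q).Nonempty := by
  let t : ℕ → State d := fun n => n.rec (stateOf hd p q .a)
    fun _ s => stateOf hd s.countA s.countB .a
  exact ⟨t, permitted_stateOf hd (by simp), fun i => permitted_stateOf hd (by simp)⟩

/-! ### Counting truncated walks -/

/-- The walk stopped at time `n`. -/
def stopAt (n : ℕ) (f : ℕ → ℤ) : ℕ → ℤ := fun i => f (min i n)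

theorem stopAt_eq_iff {n : ℕ} {f g : ℕ → ℤ} : stopAt n f = stopAt n g ↔ ∀ i ≤ n, f i = g i := by
  refine ⟨fun h i hi => ?_, fun h => funext fun i => h _ (min_le_right _ _)⟩
  simpa [stopAt, hi] using congrFun h i

/-- The extension of a finite sequence by its last entry. -/
def extend {r : ℕ} (w : Fin (r + 1) → State d) : ℕ → State d :=
  fun i => w ⟨min i r, by omega⟩

theorem extend_restrict {r i : ℕ} (t : ℕ → State d) (hi : i ≤ r) :
    extend (fun j : Fin (r + 1) => t j) i = t i := by
  simp [extend, hi]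

theorem extend_injective {r : ℕ} {w w' : Fin (r + 1) → State d}
    (h : ∀ i ≤ r, extend w i = extend w' i) : w = w' := by
  funext i
  have hi : (i : ℕ) ≤ r := by omega
  simpa [extend, hi] using h i hi

theorem walk_congr {s t : ℕ → State d} {n k : ℕ} (h : ∀ i < n, s i = t i)
    (hk : k ≤ prefixLength (letters s) n) : walk s k = walk t k :=
  decode_congr (fun j hj => congrArg State.letter (h j hj)) hk

theorem walk_congr_of_le {s t : ℕ → State d} {n k : ℕ} (h : ∀ i ≤ n, s i = t i)
    (hk : k ≤ n) : walk s k = walk t k := by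
  refine walk_congr (n := n + 1) (fun i hi => h i (by omega)) ?_
  have := two_mul_le_prefixLength (letters s) (n + 1)
  omega

theorem eq_of_walk_eq {p q r : ℕ} {s t : ℕ → State d} (hs : s ∈ trajectories d p q)
    (ht : t ∈ trajectories d p q) (h : ∀ i ≤ 3 * (r + 1), walk s i = walk t i) :
    ∀ i ≤ r, s i = t i :=
  eq_of_letters_eq hs ht (eq_of_decode_eq h)

theorem finite_stopAt_walk (n : ℕ) (S : Set (ℕ → State d)) :
    (stopAt n '' (walk '' S)).Finite := by
  refine (Set.finite_range fun w : Fin (n + 1) → State d => stopAt n (walk (extend w))).subset ?_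
  rintro _ ⟨_, ⟨t, -, rfl⟩, rfl⟩
  exact ⟨fun j => t j, stopAt_eq_iff.2 fun i hi =>
    walk_congr_of_le (fun j hj => extend_restrict t hj) hi⟩

/-- The number of walks with `m` steps that continue a path with counters `p` and `q`. -/
noncomputable def numWalks (d p q m : ℕ) : ℕ := (stopAt m '' (walk '' trajectories d p q)).ncard

theorem numWalks_pos (hd : 1 ≤ d) (p q m : ℕ) : 0 < numWalks d p q m :=
  (Set.ncard_pos (finite_stopAt_walk _ _)).2 (((trajectories_nonempty hd p q).image _).image _)

/-- The trajectories that agree with `w` at the times `0, …, r`. -/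
def trajectoriesFrom (p q : ℕ) (w : ℕ → State d) (r : ℕ) : Set (ℕ → State d) :=
  {t ∈ trajectories d p q | ∀ i ≤ r, t i = w i}

/-- The finite sequence `w 0, …, w r` is an initial piece of a trajectory. -/
def PermittedPath (p q : ℕ) (w : ℕ → State d) (r : ℕ) : Prop :=
  Permitted p q (w 0) ∧ ∀ i < r, Admissible (w i) (w (i + 1))

theorem trajectoriesFrom_eq_empty {p q r : ℕ} {w : ℕ → State d} (h : ¬ PermittedPath p q w r) :
    trajectoriesFrom p q w r = ∅ := by
  refine Set.eq_empty_of_forall_notMem fun t ht => h ⟨?_, fun i hi => ?_⟩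
  · rw [← ht.2 0 (Nat.zero_le _)]; exact ht.1.1
  · rw [← ht.2 i hi.le, ← ht.2 (i + 1) hi]; exact ht.1.2 i

/-- After the prescribed states only the counters of `w r` matter. Prepending the fixed initial walk
is a bijection from the truncated continuations. -/
theorem ncard_stopAt_trajectoriesFrom {p q r : ℕ} {w : ℕ → State d} (h : PermittedPath p q w r)
    (m : ℕ) :
    (stopAt (prefixLength (letters w) (r + 1) + m) '' (walk '' trajectoriesFrom p q w r)).ncard =
      numWalks d (w r).countA (w r).countB m := by
  set l := prefixLength (letters w) (r + 1) with hl
  -- `J` puts the first `l` steps of the walk of `w` in front of a walk started at 0.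
  let J : (ℕ → ℤ) → ℕ → ℤ := fun u i => if i < l then walk w i else walk w l + u (i - l)
  have hJ : Function.Injective J := by
    intro u v huv
    funext i
    simpa [J] using congrFun huv (l + i)
  have key : ∀ t : ℕ → State d, (∀ i ≤ r, t i = w i) →
      stopAt (l + m) (walk t) = J (stopAt m (walk fun i => t (r + 1 + i))) := by
    intro t ht
    have hl' : prefixLength (letters t) (r + 1) = l :=
      prefixLength_congr fun i hi => congrArg State.letter (ht i (by omega))
    have hw : ∀ k ≤ l, walk t k = walk w k := fun k hk =>
      walk_congr (n := r + 1) (fun i hi => ht i (by omega)) (hk.trans hl'.ge)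
    funext i
    rcases lt_or_ge i l with hi | hi
    · simp only [stopAt, J, if_pos hi, min_eq_left (show i ≤ l + m by omega)]
      exact hw i hi.le
    · obtain ⟨j, rfl⟩ := Nat.exists_eq_add_of_le hi
      simp only [stopAt, J, if_neg (not_lt.2 hi), Nat.add_sub_cancel_left, ← hw l le_rfl,
        Nat.add_min_add_left]
      rw [← hl']
      exact decode_prefixLength_add _ _ _
  rw [numWalks, ← Set.ncard_image_of_injective (stopAt m '' _) hJ]
  congr 1
  ext u
  constructor
  · rintro ⟨_, ⟨t, ht, rfl⟩, rfl⟩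
    refine ⟨_, ⟨_, ⟨fun i => t (r + 1 + i), ⟨?_, fun i => ht.1.2 _⟩, rfl⟩, rfl⟩, (key t ht.2).symm⟩
    have := ht.1.2 r
    rw [Admissible, ht.2 r le_rfl] at this
    exact this
  · rintro ⟨_, ⟨_, ⟨t', ht', rfl⟩, rfl⟩, rfl⟩
    let t : ℕ → State d := fun i => if i ≤ r then w i else t' (i - (r + 1))
    have e1 : ∀ i ≤ r, t i = w i := fun i hi => if_pos hi
    have e2 : ∀ i, t (r + 1 + i) = t' i := fun i => by
      simp only [t, if_neg (show ¬ r + 1 + i ≤ r by omega), Nat.add_sub_cancel_left]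
    refine ⟨_, ⟨t, ⟨⟨?_, fun i => ?_⟩, e1⟩, rfl⟩, ?_⟩
    · rw [e1 0 (Nat.zero_le _)]; exact h.1
    · rcases lt_trichotomy i r with hi | rfl | hi
      · rw [e1 i hi.le, e1 (i + 1) hi]; exact h.2 i hi
      · rw [e1 i le_rfl, show i + 1 = i + 1 + 0 from rfl, e2]; exact ht'.1
      · obtain ⟨j, rfl⟩ := Nat.exists_eq_add_of_le (show r + 1 ≤ i from hi)
        rw [e2, add_assoc, e2]; exact ht'.2 j
    · rw [key t e1]; simp only [e2]

/-- A walk of at least $3(r+1)$ steps displays its first $r+1$ letters, hence its first $r+1$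
states. Distinct prefixes therefore give disjoint sets of truncated walks. -/
theorem ncard_stopAt_iUnion {p q r n : ℕ} (hn : 3 * (r + 1) ≤ n) {ι : Type*} [Fintype ι]
    (w : ι → ℕ → State d) (hw : ∀ i j, (∀ k ≤ r, w i k = w j k) → i = j) :
    (stopAt n '' (walk '' ⋃ i, trajectoriesFrom p q (w i) r)).ncard =
      ∑ i, (stopAt n '' (walk '' trajectoriesFrom p q (w i) r)).ncard := by
  rw [Set.image_iUnion, Set.image_iUnion,
    Set.ncard_iUnion_of_finite (fun i => finite_stopAt_walk _ _), finsum_eq_sum_of_fintype]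
  intro i j hij
  refine Set.disjoint_left.2 ?_
  rintro _ ⟨_, ⟨s, hs, rfl⟩, rfl⟩ ⟨_, ⟨t, ht, rfl⟩, h⟩
  refine hij (hw i j fun k hk => ?_)
  rw [← hs.2 k hk, ← ht.2 k hk]
  exact eq_of_walk_eq hs.1 ht.1 (fun i hi => (stopAt_eq_iff.1 h i (by omega)).symm) k hk

open Classical in
-- Classification by the first state. Three steps are enough to contain the first letter entirely,
-- so no walk is counted twice.
theorem numWalks_add_three (p q m : ℕ) :
    numWalks d p q (m + 3) = ∑ t : State d, if Permitted p q t then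
      numWalks d t.countA t.countB (m + 3 - t.letter.steps.length) else 0 := by
  have hU : trajectories d p q = ⋃ t : State d, trajectoriesFrom p q (fun _ => t) 0 := by
    ext t
    simp [trajectoriesFrom]
  rw [numWalks, hU, ncard_stopAt_iUnion (by omega) _ fun i j h => h 0 le_rfl]
  refine Finset.sum_congr rfl fun t _ => ?_
  have hlen := t.letter.length_steps
  split_ifs with h
  · rw [← ncard_stopAt_trajectoriesFrom (r := 0) (w := fun _ => t) ⟨h, by simp⟩]
    have : prefixLength (letters fun _ => t) (0 + 1) = t.letter.steps.length := by
      simp [prefixLength, letters]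
    rw [this, show t.letter.steps.length + (m + 3 - t.letter.steps.length) = m + 3 by omega]
  · rw [trajectoriesFrom_eq_empty fun h' => h h'.1]; simp

/-! ### Uniform probabilities as ratios of counts -/

/-- The elements of `Hom(P_{n,d}, 0)` that extend to an element of `S`. -/
def restrictions (n d : ℕ) (S : Set (ℕ → ℤ)) : Set (ZHom (lineGraph n d) 0) :=
  {g | ∃ f ∈ S, ∀ i : Fin (n + 1), g.1 i = f i}

theorem ncard_restrictions {n : ℕ} {S : Set (ℕ → ℤ)} (hS : S ⊆ ZHom (halfLineGraph d) 0) :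
    (restrictions n d S).ncard = (stopAt n '' S).ncard := by
  let e : ZHom (lineGraph n d) 0 → ℕ → ℤ := fun g i => g.1 ⟨min i n, by omega⟩
  have he : Function.Injective e := by
    intro g g' h
    refine Subtype.ext (funext fun i => ?_)
    have hi : (i : ℕ) ≤ n := by omega
    simpa [e, hi] using congrFun h i
  rw [← Set.ncard_image_of_injective _ he]
  congr 1
  ext u
  constructor
  · rintro ⟨g, ⟨f, hf, hg⟩, rfl⟩
    exact ⟨f, hf, funext fun i => (hg ⟨min i n, by omega⟩).symm⟩
  · rintro ⟨f, hf, rfl⟩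
    have := mem_ZHom_halfLineGraph_iff.1 (hS hf)
    exact ⟨⟨fun i => f i, mem_ZHom_lineGraph_iff.2 ⟨this.1, this.2 n⟩⟩, ⟨f, hf, fun _ => rfl⟩, rfl⟩

theorem exists_extension {n : ℕ} (g : ZHom (lineGraph n d) 0) :
    ∃ f ∈ ZHom (halfLineGraph d) 0, ∀ i : Fin (n + 1), g.1 i = f i := by
  let f : ℕ → ℤ := fun i => g.1 ⟨min i n, by omega⟩
  have hf : ∀ i : Fin (n + 1), f i = g.1 i := fun i => by
    have hi : (i : ℕ) ≤ n := by omega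
    simp [f, hi]
  have : (fun i : Fin (n + 1) => f i) ∈ ZHom (lineGraph n d) 0 := by
    rw [show (fun i : Fin (n + 1) => f i) = g.1 from funext hf]; exact g.2
  obtain ⟨h0, h⟩ := mem_ZHom_lineGraph_iff.1 this
  obtain ⟨f', hf', h'⟩ := h.exists_extension h0
  exact ⟨f', hf', fun i => by rw [h' i (by omega), hf]⟩

/-- Every finite homomorphism extends to the half-line, so the denominator is the number of all
truncated walks. -/
theorem uniformHom_real_restrictions (hd : 1 ≤ d) {n : ℕ} {S : Set (ℕ → ℤ)}
    (hS : S ⊆ ZHom (halfLineGraph d) 0) :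
    (uniformHom n d).real (restrictions n d S) = (stopAt n '' S).ncard / numWalks d d d n := by
  have huniv : (Set.univ : Set (ZHom (lineGraph n d) 0)) =
      restrictions n d (ZHom (halfLineGraph d) 0) := by
    symm; rw [Set.eq_univ_iff_forall]; exact exists_extension
  have hcard : Nat.card (ZHom (lineGraph n d) 0) = numWalks d d d n := by
    rw [← Set.ncard_univ, huniv, ncard_restrictions subset_rfl, numWalks,
      walk_image_trajectories hd]
  have hfin : Finite (ZHom (lineGraph n d) 0) := Nat.finite_of_card_ne_zero
    (hcard ▸ (numWalks_pos hd d d n).ne')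
  have := Fintype.ofFinite (ZHom (lineGraph n d) 0)
  rw [uniformHom, Measure.real, uniformOn_univ, ENNReal.toReal_div, ← hcard,
    ← Nat.card_eq_fintype_card, ← ncard_restrictions hS,
    Measure.count_apply_finite _ (Set.toFinite _), ← Set.ncard_eq_toFinset_card]
  simp

theorem finiteCylinder_eq_restrictions {n r : ℕ} (hn : r ≤ n) (f : Fin (r + 1) → ℤ) :
    finiteCylinder n d r f =
      restrictions n d {g ∈ ZHom (halfLineGraph d) 0 | ∀ j : Fin (r + 1), g j = f j} := by
  ext g
  constructor
  · intro h
    obtain ⟨g', hg', e⟩ := exists_extension g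
    exact ⟨g', ⟨hg', fun j => by
      rw [← h ⟨j, by omega⟩ j rfl, e]⟩, e⟩
  · rintro ⟨g', ⟨-, h⟩, e⟩ i j hij
    rw [e, ← h j, hij]

open Classical in
/-- The paths of `r + 1` states whose walk starts with `f`. -/
noncomputable def compatiblePaths (d r : ℕ) (f : Fin (r + 1) → ℤ) :
    Finset (Fin (r + 1) → State d) :=
  {w | ∀ j : Fin (r + 1), walk (extend w) j = f j}

theorem restrict_mem_compatiblePaths_iff {r : ℕ} {f : Fin (r + 1) → ℤ} {t : ℕ → State d} :
    (fun j : Fin (r + 1) => t j) ∈ compatiblePaths d r f ↔ ∀ j : Fin (r + 1), walk t j = f j := by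
  simp only [compatiblePaths, Finset.mem_filter, Finset.mem_univ, true_and]
  refine forall_congr' fun j => ?_
  rw [walk_congr_of_le (n := r) (fun i hi => extend_restrict t hi) (by omega)]

/-- The values up to time `r` are determined by the first `r + 1` states, so the cylinder splits
over compatible paths. -/
theorem uniformHom_real_finiteCylinder (hd : 1 ≤ d) {n r : ℕ} (hn : 3 * (r + 1) ≤ n)
    (f : Fin (r + 1) → ℤ) :
    (uniformHom n d).real (finiteCylinder n d r f) = ∑ w ∈ compatiblePaths d r f,
      ((stopAt n '' (walk '' trajectoriesFrom d d (extend w) r)).ncard : ℝ) /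
        numWalks d d d n := by
  rw [finiteCylinder_eq_restrictions (by omega),
    uniformHom_real_restrictions hd (Set.sep_subset _ _), ← Finset.sum_div,
    ← Finset.sum_coe_sort, ← Nat.cast_sum,
    ← ncard_stopAt_iUnion hn (fun w : compatiblePaths d r f => extend w.1)
      fun i j h => Subtype.ext (extend_injective h)]
  congr 4
  ext g
  rw [← walk_image_trajectories hd]
  constructor
  · rintro ⟨⟨t, ht, rfl⟩, h⟩
    exact ⟨t, Set.mem_iUnion.2 ⟨⟨_, restrict_mem_compatiblePaths_iff.2 h⟩, ht,
      fun i hi => (extend_restrict t hi).symm⟩, rfl⟩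
  · rintro ⟨t, ht, rfl⟩
    obtain ⟨⟨w, hw⟩, ht, hwt⟩ := Set.mem_iUnion.1 ht
    refine ⟨⟨t, ht, rfl⟩, restrict_mem_compatiblePaths_iff.1 ?_⟩
    convert hw using 1
    exact extend_injective fun i hi => by rw [extend_restrict t hi, hwt i hi]

/-! ### Convergence under a stochastic matrix -/

/-- Powers of a stochastic matrix with a power that has a positive column average out every
vector. -/
theorem exists_tendsto_of_stochastic {ι : Type*} [Fintype ι] [DecidableEq ι] [Nonempty ι]
    {Q : Matrix ι ι ℝ} (hQ : Q ∈ Matrix.rowStochastic ℝ ι) {N : ℕ} {j₀ : ι}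
    (hN : ∀ i, 0 < (Q ^ N) i j₀) {v : ℕ → ι → ℝ} (hv : ∀ n, v (n + 1) = Q.mulVec (v n))
    (hpos : ∀ i, 0 < v 0 i) :
    ∃ c, 0 < c ∧ ∀ i, Tendsto (fun n => v n i) atTop (𝓝 c) := by
  have hvm : ∀ m n, v (n + m) = (Q ^ m).mulVec (v n) := by
    intro m n
    induction m with
    | zero => simp
    | succ m ih => rw [← add_assoc, hv, ih, Matrix.mulVec_mulVec, ← pow_succ']
  have hR : ∀ m, (∀ i j, 0 ≤ (Q ^ m) i j) ∧ ∀ i, ∑ j, (Q ^ m) i j = 1 := fun m => by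
    have := Matrix.mem_rowStochastic_iff_sum.1 (pow_mem hQ m)
    exact this
  let lo : ℕ → ℝ := fun n => ⨅ i, v n i
  let hi : ℕ → ℝ := fun n => ⨆ i, v n i
  have hlo : ∀ n i, lo n ≤ v n i := fun n i => ciInf_le (Set.finite_range _).bddBelow i
  have hhi : ∀ n i, v n i ≤ hi n := fun n i => le_ciSup (Set.finite_range _).bddAbove i
  have above : ∀ m n i j, (Q ^ m) i j * (hi n - v n j) ≤ hi n - v (n + m) i := by
    intro m n i j
    have : hi n - v (n + m) i = ∑ k, (Q ^ m) i k * (hi n - v n k) := by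
      simp only [mul_sub, Finset.sum_sub_distrib, ← Finset.sum_mul, (hR m).2, one_mul, hvm]
      rfl
    rw [this]
    exact Finset.single_le_sum (f := fun k => (Q ^ m) i k * (hi n - v n k))
      (fun k _ => mul_nonneg ((hR m).1 i k) (sub_nonneg.2 (hhi n k))) (Finset.mem_univ j)
  have below : ∀ m n i j, (Q ^ m) i j * (v n j - lo n) ≤ v (n + m) i - lo n := by
    intro m n i j
    have : v (n + m) i - lo n = ∑ k, (Q ^ m) i k * (v n k - lo n) := by
      simp only [mul_sub, Finset.sum_sub_distrib, ← Finset.sum_mul, (hR m).2, one_mul, hvm]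
      rfl
    rw [this]
    exact Finset.single_le_sum (f := fun k => (Q ^ m) i k * (v n k - lo n))
      (fun k _ => mul_nonneg ((hR m).1 i k) (sub_nonneg.2 (hlo n k))) (Finset.mem_univ j)
  have hlo_mono : Monotone lo := monotone_nat_of_le_succ fun n => le_ciInf fun i => by
    have h1 := below 1 n i i
    have h2 := mul_nonneg ((hR 1).1 i i) (sub_nonneg.2 (hlo n i))
    linarith
  have hhi_anti : Antitone hi := antitone_nat_of_succ_le fun n => ciSup_le fun i => by
    have h1 := above 1 n i i
    have h2 := mul_nonneg ((hR 1).1 i i) (sub_nonneg.2 (hhi n i))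
    linarith
  have hlohi : ∀ n, lo n ≤ hi n := fun n => (hlo n (Classical.arbitrary ι)).trans (hhi n _)
  obtain ⟨i₁, hi₁⟩ := Finite.exists_min fun i => (Q ^ N) i j₀
  set δ := (Q ^ N) i₁ j₀ with hδ
  -- Every entry of `v (n + N)` is an average giving weight at least `δ` to the same value `v n j₀`.
  -- Both the maximum and the minimum are pulled towards it, which shrinks the oscillation by `1 -
  -- δ`.
  have contract : ∀ n, hi (n + N) - lo (n + N) ≤ (1 - δ) * (hi n - lo n) := by
    intro n
    have h1 : hi (n + N) ≤ hi n - δ * (hi n - v n j₀) := ciSup_le fun i => by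
      have h1 := above N n i j₀
      have h2 := mul_le_mul_of_nonneg_right (hi₁ i) (sub_nonneg.2 (hhi n j₀))
      linarith
    have h2 : lo n + δ * (v n j₀ - lo n) ≤ lo (n + N) := le_ciInf fun i => by
      have h1 := below N n i j₀
      have h2 := mul_le_mul_of_nonneg_right (hi₁ i) (sub_nonneg.2 (hlo n j₀))
      linarith
    linarith
  have tlo : Tendsto lo atTop (𝓝 (⨆ n, lo n)) := tendsto_atTop_ciSup hlo_mono
    ⟨hi 0, by rintro _ ⟨n, rfl⟩; exact (hlohi n).trans (hhi_anti (Nat.zero_le n))⟩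
  have thi : Tendsto hi atTop (𝓝 (⨅ n, hi n)) := tendsto_atTop_ciInf hhi_anti
    ⟨lo 0, by rintro _ ⟨n, rfl⟩; exact (hlo_mono (Nat.zero_le n)).trans (hlohi n)⟩
  -- The limiting oscillation $g$ satisfies $0\le g\le(1-\delta)g$.
  have heq : (⨅ n, hi n) = ⨆ n, lo n := by
    have tg := thi.sub tlo
    have h1 := le_of_tendsto_of_tendsto' (tg.comp (tendsto_add_atTop_nat N)) (tg.const_mul (1 - δ))
      contract
    have h2 := ge_of_tendsto' tg fun n => sub_nonneg.2 (hlohi n)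
    have h3 : 0 < δ := hN i₁
    nlinarith
  rw [heq] at thi
  refine ⟨⨆ n, lo n, ?_, fun i => tendsto_of_tendsto_of_tendsto_of_le_of_le tlo thi
    (fun n => hlo n i) fun n => hhi n i⟩
  obtain ⟨i₂, hi₂⟩ := Finite.exists_min (v 0)
  calc 0 < v 0 i₂ := hpos i₂
    _ ≤ lo 0 := le_ciInf hi₂
    _ ≤ _ := hlo_mono.ge_of_tendsto tlo 0

/-! ### The growth rate and the harmonic weight -/

variable {lam : ℝ}

theorem IsRate.two_lt (h : IsRate d lam) : 2 < lam := by
  by_contra hle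
  have := mul_nonpos_of_nonneg_of_nonpos (Real.rpow_nonneg h.1.le ((d : ℝ) - 1 / 2))
    (sub_nonpos.2 (not_lt.1 hle))
  linarith [h.2]

theorem IsRate.unique (hd : 1 ≤ d) {lam' : ℝ} (h : IsRate d lam) (h' : IsRate d lam') :
    lam' = lam := by
  have hd' : (0 : ℝ) < (d : ℝ) - 1 / 2 := by
    have : (1 : ℝ) ≤ d := by exact_mod_cast hd
    linarith
  have key : ∀ {x y : ℝ}, IsRate d x → IsRate d y → ¬ x < y := by
    intro x y hx hy hxy
    have h1 := Real.rpow_lt_rpow hx.1.le hxy hd'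
    have h2 := Real.rpow_pos_of_pos hx.1 ((d : ℝ) - 1 / 2)
    have h3 := hx.2
    have h4 := hy.2
    have h5 := hx.two_lt
    nlinarith
  exact le_antisymm (not_lt.1 (key h h')) (not_lt.1 (key h' h))

theorem exists_isRate (hd : 1 ≤ d) : ∃ lam, IsRate d lam := by
  have hd' : (0 : ℝ) ≤ (d : ℝ) - 1 / 2 := by
    have : (1 : ℝ) ≤ d := by exact_mod_cast hd
    linarith
  have hc : ContinuousOn (fun x : ℝ => x ^ ((d : ℝ) - 1 / 2) * (x - 2)) (Set.Icc 2 3) :=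
    ((Real.continuous_rpow_const hd').mul (continuous_id.sub continuous_const)).continuousOn
  have h3 : (1 : ℝ) ≤ (3 : ℝ) ^ ((d : ℝ) - 1 / 2) := Real.one_le_rpow (by norm_num) hd'
  obtain ⟨x, hx, hx'⟩ := intermediate_value_Icc (by norm_num) hc
    (show (1 : ℝ) ∈ Set.Icc _ _ by constructor <;> norm_num; linarith)
  exact ⟨x, by linarith [hx.1], hx'⟩

theorem IsRate.pow_mul (h : IsRate d lam) : lam ^ d * (lam - 2) = √lam := by
  have h2 := h.2
  rw [Real.rpow_sub h.1, Real.rpow_natCast, ← Real.sqrt_eq_rpow] at h2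
  have : √lam ≠ 0 := (Real.sqrt_pos.2 h.1).ne'
  field_simp at h2
  linarith

/-- The harmonic weight of the states `a_k` and `b_k`. -/
noncomputable def levelWeight (lam : ℝ) (k : ℕ) : ℝ :=
  (lam ^ k * (lam - 2) + lam) / (lam * (lam - 1))

theorem levelWeight_pos (h : 2 < lam) (k : ℕ) : 0 < levelWeight lam k := by
  have : 0 < lam ^ k := by positivity
  have h2 : 0 < lam - 2 := by linarith
  have h1 : 0 < lam - 1 := by linarith
  unfold levelWeight; positivity

theorem levelWeight_one (h : 2 < lam) : levelWeight lam 1 = 1 := by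
  have h1 : lam - 1 ≠ 0 := by linarith
  have h0 : lam ≠ 0 := by linarith
  unfold levelWeight; field_simp; ring

/-- This is harmonicity at $a_k$ for $k<d$: the successors $a_{k+1}$ and $b_1$ have two steps each,
and $b_1$ has weight 1. -/
theorem levelWeight_succ (h : 2 < lam) (k : ℕ) :
    levelWeight lam (k + 1) = lam * levelWeight lam k - 1 := by
  have h1 : lam - 1 ≠ 0 := by linarith
  have h0 : lam ≠ 0 := by linarith
  unfold levelWeight; field_simp; ring

theorem turnProb_eq (h : 2 < lam) (k : ℕ) : turnProb lam k = (lam * levelWeight lam k)⁻¹ := by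
  have h1 : lam - 1 ≠ 0 := by linarith
  have h0 : lam ≠ 0 := by linarith
  have : lam ^ k * (lam - 2) + lam ≠ 0 := by
    have : 0 < lam ^ k * (lam - 2) := mul_pos (by positivity) (by linarith)
    linarith
  unfold turnProb levelWeight; field_simp

/-- This is harmonicity at $a_d$, namely $h_d=z^2h_d+z^2+z^3$ with $z=\lambda^{-1/2}$, and here the
rate equation enters. -/
theorem IsRate.levelWeight_eq (h : IsRate d lam) :
    levelWeight lam d = (√lam * (√lam - 1))⁻¹ := by
  have hs : 1 < √lam := Real.lt_sqrt_of_sq_lt (by linarith [h.two_lt])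
  have hsq : √lam ^ 2 = lam := Real.sq_sqrt h.1.le
  rw [levelWeight, h.pow_mul]
  set s := √lam
  rw [← hsq]
  have h1 : s - 1 ≠ 0 := by linarith
  have h2 : s + 1 ≠ 0 := by linarith
  have h3 : s ≠ 0 := by linarith
  have h4 : s ^ 2 - 1 ≠ 0 := by
    rw [show s ^ 2 - 1 = (s - 1) * (s + 1) by ring]; exact mul_ne_zero h1 h2
  field_simp
  ring

/-- The harmonic weight of a state. -/
noncomputable def State.weight (lam : ℝ) : State d → ℝ
  | .a k => levelWeight lam (k + 1)
  | .b k => levelWeight lam (k + 1)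
  | .A => 1
  | .B => 1

theorem State.weight_pos (h : 2 < lam) (s : State d) : 0 < s.weight lam := by
  cases s with
  | a k => exact levelWeight_pos h _
  | b k => exact levelWeight_pos h _
  | A => exact one_pos
  | B => exact one_pos

theorem State.swap_swap (s : State d) : s.swap.swap = s := by cases s <;> rfl

theorem State.weight_swap (s : State d) : s.swap.weight lam = s.weight lam := by cases s <;> rfl

theorem State.length_steps_swap (s : State d) :
    s.swap.letter.steps.length = s.letter.steps.length := by cases s <;> rfl

theorem admissible_swap {s t : State d} : Admissible s.swap t.swap ↔ Admissible s t := by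
  cases s <;> cases t <;> rfl

theorem trans_swap (s t : State d) : trans d lam s.swap t.swap = trans d lam s t := by
  cases s <;> simp only [State.swap, trans] <;> cases t <;> rfl

theorem sum_swap (f : State d → ℝ) : ∑ t : State d, f t.swap = ∑ t, f t :=
  Equiv.sum_comp ⟨State.swap, State.swap, State.swap_swap, State.swap_swap⟩ f

theorem State.induction_swap {motive : State d → Prop} (ha : ∀ k, motive (.a k)) (hA : motive .A)
    (hswap : ∀ s, motive s → motive s.swap) (s : State d) : motive s := by
  cases s with
  | a k => exact ha k
  | A => exact hA
  | b k => exact hswap _ (ha k)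
  | B => exact hswap _ hA

theorem ite_eq_ite_of_iff {P Q : Prop} {hP : Decidable P} {hQ : Decidable Q} {x y : ℝ}
    (h : P ↔ Q) (hxy : P → x = y) : (if P then x else 0) = if Q then y else 0 :=
  if_ctx_congr h (fun hq => hxy (h.2 hq)) fun _ => rfl

open Classical in
-- The chain is the Doob transform of the weighted transition graph. The states `A` and $a_1$ have
-- equal counters, hence the same continuations and the same weight 1.
theorem trans_eq (hd : 1 ≤ d) (h : IsRate d lam) (s t : State d) :
    trans d lam s t = if Admissible s t then
      (√lam)⁻¹ ^ t.letter.steps.length * t.weight lam / s.weight lam else 0 := by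
  have h2 := h.two_lt
  have hs : 1 < √lam := Real.lt_sqrt_of_sq_lt (by linarith)
  have hsq : √lam ^ 2 = lam := Real.sq_sqrt h.1.le
  have hs0 : √lam ≠ 0 := by linarith
  have hs1 : √lam - 1 ≠ 0 := by linarith
  have hz2 : (√lam)⁻¹ ^ 2 = lam⁻¹ := by rw [inv_pow, hsq]
  have hlam : lam ≠ 0 := by linarith
  have hw1 := levelWeight_one h2
  induction s using State.induction_swap generalizing t with
  | hswap s ih =>
    rw [← State.swap_swap t, trans_swap, ih]
    simp only [admissible_swap, State.weight_swap, State.length_steps_swap]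
  | ha k =>
    have hk := k.2
    have hwk := (levelWeight_pos h2 (k + 1)).ne'
    cases t with
    | a j =>
      have hadm : Admissible (.a k) (.a j) ↔ (j : ℕ) + 1 = min ((k : ℕ) + 1 + 1) d := Iff.rfl
      simp only [trans, transA]
      by_cases hkd : (k : ℕ) + 1 < d
      · rw [if_pos hkd, turnProb_eq h2]
        refine ite_eq_ite_of_iff (by rw [hadm]; omega) fun e => ?_
        change _ = (√lam)⁻¹ ^ 2 * levelWeight lam (j + 1) / levelWeight lam (k + 1)
        rw [hz2, e, levelWeight_succ h2 (k + 1)]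
        field_simp
      · rw [if_neg hkd]
        refine ite_eq_ite_of_iff (by rw [hadm, Fin.ext_iff]; omega) fun e => ?_
        change _ = (√lam)⁻¹ ^ 2 * levelWeight lam (j + 1) / levelWeight lam (k + 1)
        rw [hz2, e, mul_div_cancel_right₀ _ hwk]
    | b j =>
      have hadm : Admissible (.a k) (.b j) ↔ (j : ℕ) + 1 = min (0 + 1) d := Iff.rfl
      refine ite_eq_ite_of_iff (by rw [hadm]; omega) fun e => ?_
      change _ = (√lam)⁻¹ ^ 2 * levelWeight lam (j + 1) / levelWeight lam (k + 1)
      rw [hz2, turnProb_eq h2, e, zero_add, hw1, mul_inv]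
      ring
    | A =>
      refine ite_eq_ite_of_iff Iff.rfl fun e => ?_
      change _ = (√lam)⁻¹ ^ 3 * 1 / levelWeight lam (k + 1)
      rw [e, turnProb_eq h2, h.levelWeight_eq]
      nth_rewrite 1 2 [← hsq]
      field_simp
      ring
    | B => exact (if_neg (show ¬ 0 = d by omega)).symm
  | hA =>
    cases t with
    | a j =>
      have hadm : Admissible .A (.a j) ↔ (j : ℕ) + 1 = min (1 + 1) d := Iff.rfl
      have hj := j.2
      simp only [trans, transA]
      by_cases hd1 : d = 1
      · rw [if_pos hd1, if_pos (hadm.2 (by omega))]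
        change _ = (√lam)⁻¹ ^ 2 * levelWeight lam (j + 1) / 1
        rw [hz2, show (j : ℕ) = 0 by omega, zero_add, hw1]
        ring
      · rw [if_neg hd1]
        refine ite_eq_ite_of_iff (by rw [hadm]; omega) fun e => ?_
        change _ = (√lam)⁻¹ ^ 2 * levelWeight lam (j + 1) / 1
        rw [hz2, e, levelWeight_succ h2, hw1]
        field_simp
    | b j =>
      have hadm : Admissible .A (.b j) ↔ (j : ℕ) + 1 = min (0 + 1) d := Iff.rfl
      refine ite_eq_ite_of_iff (by rw [hadm]; omega) fun e => ?_
      change _ = (√lam)⁻¹ ^ 2 * levelWeight lam (j + 1) / 1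
      rw [hz2, e, zero_add, hw1]
      ring
    | A =>
      refine ite_eq_ite_of_iff eq_comm fun e => ?_
      change _ = (√lam)⁻¹ ^ 3 * 1 / 1
      have h1 := h.pow_mul
      rw [e, pow_one] at h1
      -- For $d=1$ the rate equation reads $s^3-2s=1$ with $s=\sqrt\lambda$, that is,
      -- $1-2\lambda^{-1}=s^{-3}$.
      have h3 : √lam * (√lam ^ 2 - 2) = 1 := mul_left_cancel₀ hs0 (by
        rw [hsq, ← mul_assoc, ← sq, hsq]; linarith)
      rw [← hsq, Real.sqrt_sq (by linarith)]
      field_simp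
      linarith
    | B => exact (if_neg (show ¬ 0 = d by omega)).symm

theorem sum_trans (hd : 1 ≤ d) (s : State d) : ∑ t, trans d lam s t = 1 := by
  induction s using State.induction_swap with
  | hswap s ih =>
    rw [← sum_swap]
    simpa only [trans_swap] using ih
  | ha k =>
    have hb : ∀ c : ℝ, ∑ j : Fin d, (if (j : ℕ) = 0 then c else 0) = c := fun c => by
      rw [Finset.sum_eq_single ⟨0, hd⟩ (fun j _ hj => if_neg fun e => hj (Fin.ext e)) (by simp)]
      simp
    rw [State.sum_eq]
    simp only [trans, transA, hb]
    have hk := k.2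
    by_cases hkd : (k : ℕ) + 1 < d
    · rw [if_neg hkd.ne]
      simp only [if_pos hkd]
      rw [Finset.sum_eq_single ⟨k + 1, hkd⟩ (fun j _ hj => if_neg fun e => hj (Fin.ext e))
        (by simp)]
      simp
    · have : (k : ℕ) + 1 = d := by omega
      simp only [if_neg hkd, if_pos this, Finset.sum_ite_eq', Finset.mem_univ, if_true]
      rw [this]
      ring
  | hA =>
    have hb : ∀ c : ℝ, ∑ j : Fin d, (if (j : ℕ) = 0 then c else 0) = c := fun c => by
      rw [Finset.sum_eq_single ⟨0, hd⟩ (fun j _ hj => if_neg fun e => hj (Fin.ext e)) (by simp)]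
      simp
    rw [State.sum_eq]
    simp only [trans, transA, hb]
    by_cases hd1 : d = 1
    · simp [hd1]; ring
    · simp only [if_neg hd1]
      rw [Finset.sum_eq_single ⟨1, by omega⟩ (fun j _ hj => if_neg fun e => hj (Fin.ext e))
        (by simp)]
      simp

/-- The normalization of the initial distribution. -/
noncomputable def totalWeight (d : ℕ) (lam : ℝ) : ℝ := 2 * (√lam)⁻¹ * levelWeight lam d

theorem totalWeight_pos (h : IsRate d lam) : 0 < totalWeight d lam := by
  have := levelWeight_pos h.two_lt d
  have := Real.sqrt_pos.2 h.1
  unfold totalWeight; positivity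

open Classical in
-- The start behaves like an extra state with both counters equal to $d$, whose harmonic weight is
-- `totalWeight`.
theorem initial_eq (h : IsRate d lam) (t : State d) :
    initial d lam t = if Permitted d d t then
      (√lam)⁻¹ ^ t.letter.steps.length * t.weight lam / totalWeight d lam else 0 := by
  have h2 := h.two_lt
  have hs : 1 < √lam := Real.lt_sqrt_of_sq_lt (by linarith)
  have hs0 : √lam ≠ 0 := by linarith
  have hs1 : √lam - 1 ≠ 0 := by linarith
  have hw := (levelWeight_pos h2 d).ne'
  have hA : (1 - (√lam)⁻¹) / 2 = (√lam)⁻¹ ^ 3 * 1 / totalWeight d lam := by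
    rw [totalWeight, h.levelWeight_eq]; field_simp
  have ha : ∀ (k : Fin d) (hdec : Decidable ((k : ℕ) + 1 = min (d + 1) d)),
      (if (k : ℕ) + 1 = d then (√lam)⁻¹ / 2 else 0) = if (k : ℕ) + 1 = min (d + 1) d then
        (√lam)⁻¹ ^ 2 * levelWeight lam (k + 1) / totalWeight d lam else 0 := by
    intro k hdec
    refine ite_eq_ite_of_iff (by omega) fun e => ?_
    rw [e, totalWeight]
    field_simp
  cases t with
  | a k => exact ha k _
  | b k => exact ha k _
  | A => exact hA.trans (if_pos rfl).symm
  | B => exact hA.trans (if_pos rfl).symm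

theorem sum_initial (hd : 1 ≤ d) : ∑ t, initial d lam t = 1 := by
  have : ∀ c : ℝ, ∑ k : Fin d, (if (k : ℕ) + 1 = d then c else 0) = c := fun c => by
    rw [Finset.sum_eq_single ⟨d - 1, by omega⟩
      (fun j _ hj => if_neg fun e => hj (Fin.ext (by simp; omega))) (by simp)]
    simp; omega
  rw [State.sum_eq]
  simp only [initial, this]
  ring

theorem trans_nonneg (hd : 1 ≤ d) (h : IsRate d lam) (s t : State d) : 0 ≤ trans d lam s t := by
  rw [trans_eq hd h]
  have := s.weight_pos h.two_lt
  have := t.weight_pos h.two_lt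
  split_ifs <;> positivity

theorem trans_pos_iff (hd : 1 ≤ d) (h : IsRate d lam) {s t : State d} :
    0 < trans d lam s t ↔ Admissible s t := by
  rw [trans_eq hd h]
  have := s.weight_pos h.two_lt
  have := t.weight_pos h.two_lt
  have := Real.sqrt_pos.2 h.1
  split_ifs with hst
  · exact iff_of_true (by positivity) hst
  · exact iff_of_false (lt_irrefl _) hst

theorem initial_nonneg (h : IsRate d lam) (t : State d) : 0 ≤ initial d lam t := by
  rw [initial_eq h]
  have := t.weight_pos h.two_lt
  have := totalWeight_pos h
  split_ifs <;> positivity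

/-! ### The chain in unit time and its aperiodicity -/

noncomputable instance : DecidableEq (State d) := Classical.decEq _

/-- The unit-time chain on pairs of a state and a phase; a letter with `l` steps is entered from
the phase `2` into the phase `3 - l`. -/
noncomputable def phaseMatrix (d : ℕ) (lam : ℝ) :
    Matrix (State d × Fin 3) (State d × Fin 3) ℝ := fun x y =>
  if x.2 = 2 then (if (y.2 : ℕ) + y.1.letter.steps.length = 3 then trans d lam x.1 y.1 else 0)
  else if y.1 = x.1 ∧ (y.2 : ℕ) = x.2 + 1 then 1 else 0

theorem phaseMatrix_two_sum (f : State d × Fin 3 → ℝ) (s : State d) :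
    ∑ y, phaseMatrix d lam (s, 2) y * f y =
      ∑ t, trans d lam s t * f (t, ⟨3 - t.letter.steps.length, by
        have := t.letter.length_steps; omega⟩) := by
  rw [Fintype.sum_prod_type]
  refine Finset.sum_congr rfl fun t _ => ?_
  have := t.letter.length_steps
  rw [Finset.sum_eq_single ⟨3 - t.letter.steps.length, by omega⟩]
  · simp only [phaseMatrix, if_true]
    rw [if_pos (by omega)]
  · intro j _ hj
    simp only [phaseMatrix, if_true]
    rw [if_neg, zero_mul]
    intro h
    exact hj (Fin.ext (by simp only; omega))
  · simp

theorem phaseMatrix_of_lt_sum (f : State d × Fin 3 → ℝ) (s : State d) {i j : Fin 3}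
    (hij : (j : ℕ) = i + 1) : ∑ y, phaseMatrix d lam (s, i) y * f y = f (s, j) := by
  have hi : i ≠ 2 := by rintro rfl; have := j.2; simp at hij; omega
  rw [Finset.sum_eq_single (s, j)]
  · simp [phaseMatrix, hi, hij]
  · intro y _ hy
    simp only [phaseMatrix, if_neg hi]
    rw [if_neg, zero_mul]
    exact fun h => hy (Prod.ext h.1 (Fin.ext (h.2.trans hij.symm)))
  · simp

theorem phaseMatrix_mem_rowStochastic (hd : 1 ≤ d) (h : IsRate d lam) :
    phaseMatrix d lam ∈ Matrix.rowStochastic ℝ (State d × Fin 3) := by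
  rw [Matrix.mem_rowStochastic_iff_sum]
  constructor
  · intro x y
    unfold phaseMatrix
    have := trans_nonneg hd h x.1 y.1
    split_ifs <;> first | exact this | norm_num
  · rintro ⟨s, i⟩
    have h1 : ∀ j : Fin 3, (j : ℕ) = i + 1 → ∑ y, phaseMatrix d lam (s, i) y = 1 := fun j hj => by
      simpa using phaseMatrix_of_lt_sum (lam := lam) (fun _ => 1) s hj
    fin_cases i
    · exact h1 1 rfl
    · exact h1 2 rfl
    · have := phaseMatrix_two_sum (d := d) (lam := lam) (fun _ => 1) s
      simp only [mul_one] at this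
      exact this.trans (sum_trans hd s)

theorem pow_add_pos {ι : Type*} [Fintype ι] [DecidableEq ι] {Q : Matrix ι ι ℝ}
    (hQ : Q ∈ Matrix.rowStochastic ℝ ι) {m n : ℕ} {i j k : ι} (h1 : 0 < (Q ^ m) i j)
    (h2 : 0 < (Q ^ n) j k) : 0 < (Q ^ (m + n)) i k := by
  have hm := (Matrix.mem_rowStochastic_iff_sum.1 (pow_mem hQ m)).1
  have hn := (Matrix.mem_rowStochastic_iff_sum.1 (pow_mem hQ n)).1
  rw [pow_add, Matrix.mul_apply]
  exact (mul_pos h1 h2).trans_le (Finset.single_le_sum (f := fun l => (Q ^ m) i l * (Q ^ n) l k)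
    (fun l _ => mul_nonneg (hm _ _) (hn _ _)) (Finset.mem_univ j))

/-- In `n` steps, the phase chain may move from the state `s` at phase `2` to `t` at phase `2`. -/
def Reaches (lam : ℝ) (n : ℕ) (s t : State d) : Prop :=
  0 < (phaseMatrix d lam ^ n) (s, 2) (t, 2)

theorem phaseMatrix_pos_of_lt (s : State d) {i j : Fin 3} (hij : (j : ℕ) = i + 1) :
    0 < phaseMatrix d lam (s, i) (s, j) := by
  have hi : i ≠ 2 := by rintro rfl; have := j.2; simp at hij; omega
  simp [phaseMatrix, hi, hij]

theorem pow_phaseMatrix_pos (hd : 1 ≤ d) (h : IsRate d lam) (s : State d) (i : Fin 3) :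
    0 < (phaseMatrix d lam ^ (2 - i : ℕ)) (s, i) (s, 2) := by
  have hQ := phaseMatrix_mem_rowStochastic hd h
  fin_cases i
  · refine pow_add_pos (m := 1) (n := 1) (j := (s, 1)) hQ ?_ ?_ <;> rw [pow_one] <;>
      exact phaseMatrix_pos_of_lt s rfl
  · change 0 < (phaseMatrix d lam ^ 1) (s, 1) (s, 2)
    rw [pow_one]
    exact phaseMatrix_pos_of_lt s rfl
  · change 0 < (phaseMatrix d lam ^ 0) (s, 2) (s, 2)
    simp

theorem Reaches.add (hd : 1 ≤ d) (h : IsRate d lam) {m n : ℕ} {s t u : State d}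
    (h1 : Reaches lam m s t) (h2 : Reaches lam n t u) : Reaches lam (m + n) s u :=
  pow_add_pos (phaseMatrix_mem_rowStochastic hd h) h1 h2

theorem Admissible.reaches (hd : 1 ≤ d) (h : IsRate d lam) {s t : State d} (hst : Admissible s t) :
    Reaches lam t.letter.steps.length s t := by
  have hl := t.letter.length_steps
  have h1 := pow_phaseMatrix_pos hd h t ⟨3 - t.letter.steps.length, by omega⟩
  have h2 : 0 < (phaseMatrix d lam ^ 1) (s, 2) (t, ⟨3 - t.letter.steps.length, by omega⟩) := by
    rw [pow_one]
    simp only [phaseMatrix, if_true]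
    rw [if_pos (by omega)]
    exact (trans_pos_iff hd h).2 hst
  have h3 := pow_add_pos (phaseMatrix_mem_rowStochastic hd h) h2 h1
  simp only at h3
  rw [show 1 + (2 - (3 - t.letter.steps.length)) = t.letter.steps.length by omega] at h3
  exact h3

/-- The state `a_d`. -/
def lastA (hd : 1 ≤ d) : State d := .a ⟨d - 1, by omega⟩

theorem reaches_a (hd : 1 ≤ d) (h : IsRate d lam) (s : State d) (k : ℕ) (j : Fin d)
    (hj : (j : ℕ) + 1 = min (s.countA + (k + 1)) d) : Reaches lam (2 * (k + 1)) s (.a j) := by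
  induction k generalizing j with
  | zero => exact Admissible.reaches hd h (t := .a j) hj
  | succ k ih =>
    have hlt : min (s.countA + (k + 1)) d - 1 < d := by omega
    refine (ih ⟨_, hlt⟩ (by simp only; omega)).add hd h
      (Admissible.reaches hd h (t := .a j) ?_)
    change (j : ℕ) + 1 = min (min (s.countA + (k + 1)) d - 1 + 1 + 1) d
    omega

theorem reaches_lastA (hd : 1 ≤ d) (h : IsRate d lam) (s : State d) {k : ℕ} (hk : d ≤ k) :
    Reaches lam (2 * k) s (lastA hd) := by
  obtain ⟨k, rfl⟩ : ∃ l, k = l + 1 := ⟨k - 1, by omega⟩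
  refine reaches_a hd h s k _ ?_
  simp only; omega

/-- From any state, $d$ letters `a` lead to $a_d$, and further letters `a` stay there, which gives
all large even times. Inserting one `A`, of three steps, gives odd times. -/
theorem exists_pow_phaseMatrix_pos (hd : 1 ≤ d) (h : IsRate d lam) :
    ∃ N, ∃ y, ∀ x, 0 < (phaseMatrix d lam ^ N) x y := by
  have hQ := phaseMatrix_mem_rowStochastic hd h
  -- Phase `i` uses `2 - i` steps to complete the current letter. The remaining time is even for
  -- phases 0 and 2. For phase 1 it is $2d+3+2d$, with one `A` in the middle.
  refine ⟨4 * d + 4, (lastA hd, 2), fun ⟨s, i⟩ => ?_⟩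
  have hi := pow_phaseMatrix_pos hd h s i
  have hreach : Reaches lam (4 * d + 4 - (2 - (i : ℕ))) s (lastA hd) := by
    fin_cases i
    · have := reaches_lastA hd h s (k := 2 * d + 1) (by omega)
      convert this using 1
      simp only; omega
    · have h1 := reaches_lastA hd h s le_rfl
      have h2 : Reaches lam 3 (lastA hd) State.A := Admissible.reaches hd h
        (show Admissible (lastA hd) .A from by change d - 1 + 1 = d; omega)
      have h3 := reaches_lastA hd h State.A le_rfl
      have := (h1.add hd h h2).add hd h h3
      convert this using 1
      simp only; omega
    · have := reaches_lastA hd h s (k := 2 * d + 2) (by omega)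
      convert this using 1
      simp only; omega
  have := pow_add_pos hQ hi hreach
  rwa [show 2 - (i : ℕ) + (4 * d + 4 - (2 - (i : ℕ))) = 4 * d + 4 by omega] at this

/-! ### Asymptotics of the counts -/

/-- The number of continuations of a state, rescaled by the growth rate. -/
noncomputable def scaledWalks (lam : ℝ) (s : State d) (m : ℕ) : ℝ :=
  numWalks d s.countA s.countB m * (√lam)⁻¹ ^ m / s.weight lam

theorem scaledWalks_add_three (hd : 1 ≤ d) (h : IsRate d lam) (s : State d) (m : ℕ) :
    scaledWalks lam s (m + 3) =
      ∑ t, trans d lam s t * scaledWalks lam t (m + 3 - t.letter.steps.length) := by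
  rw [scaledWalks, numWalks_add_three]
  push_cast
  rw [Finset.sum_mul, Finset.sum_div]
  refine Finset.sum_congr rfl fun t _ => ?_
  rw [trans_eq hd h]
  have hl := t.letter.length_steps
  have ht := (t.weight_pos h.two_lt).ne'
  by_cases hst : Admissible s t
  · rw [if_pos hst, if_pos (show Permitted s.countA s.countB t from hst), scaledWalks]
    rw [show (√lam)⁻¹ ^ (m + 3) = (√lam)⁻¹ ^ t.letter.steps.length *
      (√lam)⁻¹ ^ (m + 3 - t.letter.steps.length) by rw [← pow_add]; congr 1; omega]
    field_simp
  · rw [if_neg hst, if_neg (show ¬ Permitted s.countA s.countB t from hst)]; simp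

/-- The recursion with delays 2 and 3 becomes a one-step recursion for the vector indexed by state
and phase, the phase `i` recording the shift of the time by `i`. -/
theorem exists_tendsto_scaledWalks (hd : 1 ≤ d) (h : IsRate d lam) :
    ∃ c, 0 < c ∧ ∀ s : State d, Tendsto (scaledWalks lam s) atTop (𝓝 c) := by
  obtain ⟨N, y, hN⟩ := exists_pow_phaseMatrix_pos hd h
  have : Nonempty (State d × Fin 3) := ⟨y⟩
  have hv : ∀ n, (fun x : State d × Fin 3 => scaledWalks lam x.1 (n + 1 + x.2)) =
      (phaseMatrix d lam).mulVec fun x => scaledWalks lam x.1 (n + x.2) := by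
    intro n
    funext ⟨s, i⟩
    change _ = ∑ y, phaseMatrix d lam (s, i) y * _
    have h1 : ∀ j : Fin 3, (j : ℕ) = i + 1 → scaledWalks lam s (n + 1 + i) =
        ∑ y, phaseMatrix d lam (s, i) y * scaledWalks lam y.1 (n + y.2) := fun j hj => by
      rw [phaseMatrix_of_lt_sum (fun y => scaledWalks lam y.1 (n + y.2)) s hj]
      congr 1; simp only; omega
    fin_cases i
    · exact h1 1 rfl
    · exact h1 2 rfl
    · refine Eq.trans ?_ (phaseMatrix_two_sum (fun y => scaledWalks lam y.1 (n + y.2)) s).symm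
      refine (scaledWalks_add_three hd h s n).trans (Finset.sum_congr rfl fun t _ => ?_)
      have := t.letter.length_steps
      simp only
      rw [Nat.add_sub_assoc (by omega)]
  have hpos : ∀ x : State d × Fin 3, 0 < scaledWalks lam x.1 (0 + x.2) := fun x => by
    have h1 := numWalks_pos hd x.1.countA x.1.countB (0 + x.2)
    have h2 := x.1.weight_pos h.two_lt
    have h3 := Real.sqrt_pos.2 h.1
    unfold scaledWalks
    positivity
  obtain ⟨c, hc, hlim⟩ := exists_tendsto_of_stochastic (phaseMatrix_mem_rowStochastic hd h) hN
    (v := fun n x => scaledWalks lam x.1 (n + x.2)) hv hpos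
  exact ⟨c, hc, fun s => hlim (s, 0)⟩

theorem tendsto_numWalks {c : ℝ} (hd : 1 ≤ d) (h : IsRate d lam)
    (hc : ∀ s : State d, Tendsto (scaledWalks lam s) atTop (𝓝 c)) :
    Tendsto (fun n => numWalks d d d n * (√lam)⁻¹ ^ n) atTop (𝓝 (c * totalWeight d lam)) := by
  have hT := (totalWeight_pos h).ne'
  rw [← tendsto_add_atTop_iff_nat 3]
  have key : ∀ n, numWalks d d d (n + 3) * (√lam)⁻¹ ^ (n + 3) = ∑ t : State d,
      initial d lam t * scaledWalks lam t (n + (3 - t.letter.steps.length)) *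
        totalWeight d lam := by
    intro n
    rw [numWalks_add_three]
    push_cast
    rw [Finset.sum_mul]
    refine Finset.sum_congr rfl fun t _ => ?_
    rw [initial_eq h]
    have hl := t.letter.length_steps
    have ht := (t.weight_pos h.two_lt).ne'
    by_cases hst : Permitted d d t
    · rw [if_pos hst, if_pos hst, scaledWalks, Nat.add_sub_assoc (by omega)]
      rw [show (√lam)⁻¹ ^ (n + 3) = (√lam)⁻¹ ^ t.letter.steps.length *
        (√lam)⁻¹ ^ (n + (3 - t.letter.steps.length)) by rw [← pow_add]; congr 1; omega]
      field_simp
    · rw [if_neg hst, if_neg hst]; simp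
  simp only [key]
  have : c * totalWeight d lam = ∑ t : State d, initial d lam t * c * totalWeight d lam := by
    rw [← Finset.sum_mul, ← Finset.sum_mul, sum_initial hd, one_mul]
  rw [this]
  exact tendsto_finsetSum _ fun t _ =>
    (((hc t).comp (tendsto_add_atTop_nat _)).const_mul _).mul_const _

/-- The weights telescope in the product of Doob transforms, leaving the total length and the last
state. -/
theorem path_prob_of_permittedPath (hd : 1 ≤ d) (h : IsRate d lam) {w : ℕ → State d} {r : ℕ}
    (hw : PermittedPath d d w r) :
    initial d lam (w 0) * ∏ i ∈ Finset.range r, trans d lam (w i) (w (i + 1)) =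
      (√lam)⁻¹ ^ prefixLength (letters w) (r + 1) * (w r).weight lam / totalWeight d lam := by
  have hT := (totalWeight_pos h).ne'
  induction r with
  | zero => simp [initial_eq h, hw.1, prefixLength, letters]
  | succ r ih =>
    have hr := ((w r).weight_pos h.two_lt).ne'
    rw [Finset.prod_range_succ, ← mul_assoc, ih ⟨hw.1, fun i hi => hw.2 i (by omega)⟩,
      trans_eq hd h, if_pos (hw.2 r (by omega)), prefixLength_succ _ (r + 1), pow_add]
    change _ = _ * (√lam)⁻¹ ^ (w (r + 1)).letter.steps.length * _ / _
    field_simp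

theorem path_prob_of_not_permittedPath (hd : 1 ≤ d) (h : IsRate d lam) {w : ℕ → State d} {r : ℕ}
    (hw : ¬ PermittedPath d d w r) :
    initial d lam (w 0) * ∏ i ∈ Finset.range r, trans d lam (w i) (w (i + 1)) = 0 := by
  by_cases h0 : Permitted d d (w 0)
  · obtain ⟨i, hi, hi'⟩ : ∃ i < r, ¬ Admissible (w i) (w (i + 1)) := by
      by_contra! hcon
      exact hw ⟨h0, hcon⟩
    rw [Finset.prod_eq_zero (Finset.mem_range.2 hi), mul_zero]
    rw [trans_eq hd h, if_neg hi']
  · rw [initial_eq h, if_neg h0, zero_mul]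

theorem tendsto_ncard_div (hd : 1 ≤ d) (h : IsRate d lam) (w : ℕ → State d) (r : ℕ) :
    Tendsto (fun n => ((stopAt n '' (walk '' trajectoriesFrom d d w r)).ncard : ℝ) /
      numWalks d d d n) atTop
      (𝓝 (initial d lam (w 0) * ∏ i ∈ Finset.range r, trans d lam (w i) (w (i + 1)))) := by
  by_cases hw : PermittedPath d d w r
  · obtain ⟨c, hc, hlim⟩ := exists_tendsto_scaledWalks hd h
    rw [path_prob_of_permittedPath hd h hw]
    set l := prefixLength (letters w) (r + 1)
    -- At time `n + l` the prescribed letters have used `l` steps, so the numerator is a count with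
    -- `n` steps. The limit `c` is common to both counts and cancels.
    rw [← tendsto_add_atTop_iff_nat l]
    have h1 : Tendsto (fun n => scaledWalks lam (w r) n * ((√lam)⁻¹ ^ l * (w r).weight lam))
      atTop (𝓝 (c * ((√lam)⁻¹ ^ l * (w r).weight lam))) := (hlim _).mul_const _
    have h2 := (tendsto_add_atTop_iff_nat l).2 (tendsto_numWalks hd h hlim)
    have hT := (totalWeight_pos h).ne'
    have h3 := h1.div h2 (mul_ne_zero hc.ne' hT)
    rw [mul_div_mul_left _ _ hc.ne'] at h3
    refine h3.congr fun n => ?_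
    have hz := (inv_pos.2 (Real.sqrt_pos.2 h.1)).ne'
    have hwr := ((w r).weight_pos h.two_lt).ne'
    rw [Pi.div_apply, add_comm n l, ncard_stopAt_trajectoriesFrom hw, scaledWalks, pow_add]
    have := (Nat.cast_pos (α := ℝ).2 (numWalks_pos hd d d (l + n))).ne'
    set z := (√lam)⁻¹
    field_simp
  · rw [path_prob_of_not_permittedPath hd h hw, trajectoriesFrom_eq_empty hw]
    simp

theorem tendsto_uniformHom_finiteCylinder (hd : 1 ≤ d) (h : IsRate d lam) {r : ℕ}
    (f : Fin (r + 1) → ℤ) :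
    Tendsto (fun n => (uniformHom n d).real (finiteCylinder n d r f)) atTop
      (𝓝 (∑ w ∈ compatiblePaths d r f, initial d lam (extend w 0) *
        ∏ i ∈ Finset.range r, trans d lam (extend w i) (extend w (i + 1)))) := by
  refine (tendsto_finsetSum _ fun w _ => tendsto_ncard_div hd h (extend w) r).congr' ?_
  filter_upwards [eventually_ge_atTop (3 * (r + 1))] with n hn
  exact (uniformHom_real_finiteCylinder hd hn f).symm

/-! ### Markov chains on a finite state space -/

section MarkovChain

variable {S : Type} [MeasurableSpace S]

theorem measurableSet_path [DiscreteMeasurableSpace S] {Ω : Type*} [MeasurableSpace Ω]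
    {W : ℕ → Ω → S} (hW : ∀ k, Measurable (W k)) (k : ℕ) (s : ℕ → S) :
    MeasurableSet {ω | ∀ i ≤ k, W i ω = s i} := by
  simp only [Set.ofPred_forall]
  exact MeasurableSet.iInter fun i => MeasurableSet.iInter fun _ => hW i (.of_discrete (s := {s i}))

/-- The path probabilities fix the law of every initial segment. Each finite set of times lies in
such a segment, and finite-dimensional marginals determine the measure. -/
theorem IsMarkovChain.map_eq [Finite S] [DiscreteMeasurableSpace S] {Ω Ω' : Type*}
    [MeasurableSpace Ω] [MeasurableSpace Ω']
    {P : Measure Ω} {P' : Measure Ω'} {W : ℕ → Ω → S} {W' : ℕ → Ω' → S} {π : S → ℝ}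
    {p : S → S → ℝ} (h : IsMarkovChain P W π p) (h' : IsMarkovChain P' W' π p) :
    P.map (fun ω k => W k ω) = P'.map (fun ω k => W' k ω) := by
  have := h.prob
  have := h'.prob
  have hW : Measurable fun ω k => W k ω := measurable_pi_lambda _ h.meas
  have hW' : Measurable fun ω k => W' k ω := measurable_pi_lambda _ h'.meas
  have hP := Measure.isProbabilityMeasure_map (μ := P) hW.aemeasurable
  have hP' := Measure.isProbabilityMeasure_map (μ := P') hW'.aemeasurable
  have key : ∀ I : Finset ℕ, (P.map fun ω k => W k ω).map I.restrict =
      (P'.map fun ω k => W' k ω).map I.restrict := by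
    intro I
    let r := I.sup id
    have hr : ∀ i ∈ I, i < r + 1 := fun i hi => Nat.lt_succ_of_le (Finset.le_sup (f := id) hi)
    let R : (ℕ → S) → Fin (r + 1) → S := fun t j => t j
    let g : (Fin (r + 1) → S) → I → S := fun w i => w ⟨i, hr i i.2⟩
    have hR : Measurable R := measurable_pi_lambda _ fun j => measurable_pi_apply _
    have hg : Measurable g := measurable_pi_lambda _ fun j => measurable_pi_apply _
    have hgR : I.restrict = g ∘ R := rfl
    rw [hgR, ← Measure.map_map hg hR, ← Measure.map_map hg hR]
    congr 1
    refine Measure.ext_of_singleton fun w => ?_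
    have hpre : R ⁻¹' {w} = {t | ∀ i ≤ r, t i = w ⟨min i r, by omega⟩} := by
      ext t
      simp only [Set.mem_preimage, Set.mem_singleton_iff, funext_iff, R]
      constructor
      · intro h i hi
        have := h ⟨i, by omega⟩
        simpa [hi] using this
      · intro h i
        have hi : (i : ℕ) ≤ r := by omega
        simpa [hi] using h i hi
    have hw : MeasurableSet ({w} : Set (Fin (r + 1) → S)) := measurableSet_singleton _
    rw [Measure.map_apply hR hw, Measure.map_apply hR hw, Measure.map_apply hW (hR hw),
      Measure.map_apply hW' (hR hw), ← measureReal_eq_measureReal_iff, hpre]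
    exact (h.law r fun i => w ⟨min i r, by omega⟩).trans
      (h'.law r fun i => w ⟨min i r, by omega⟩).symm
  have hlim : IsProjectiveLimit (P.map fun ω k => W k ω)
    fun I : Finset ℕ => (P'.map fun ω k => W' k ω).map I.restrict := key
  have hlim' : IsProjectiveLimit (P'.map fun ω k => W' k ω)
    fun I : Finset ℕ => (P'.map fun ω k => W' k ω).map I.restrict := fun I => rfl
  have : ∀ I : Finset ℕ, IsFiniteMeasure ((P'.map fun ω k => W' k ω).map I.restrict) :=
    fun I => inferInstance
  exact hlim.unique hlim'

/-- There are only countably many finite paths, and those of probability zero form a null set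
together. -/
theorem IsMarkovChain.ae_ne_zero [Finite S] {Ω : Type*} [MeasurableSpace Ω] {P : Measure Ω}
    {W : ℕ → Ω → S} {π : S → ℝ} {p : S → S → ℝ} (h : IsMarkovChain P W π p) :
    ∀ᵐ ω ∂P, ∀ r, π (W 0 ω) * ∏ i ∈ Finset.range r, p (W i ω) (W (i + 1) ω) ≠ 0 := by
  have := h.prob
  refine ae_all_iff.2 fun r => ?_
  let e : (Fin (r + 1) → S) → ℕ → S := fun w i => w ⟨min i r, by omega⟩
  have hnull : ∀ w : Fin (r + 1) → S, ∀ᵐ ω ∂P, (∀ i ≤ r, W i ω = e w i) →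
      π (e w 0) * ∏ i ∈ Finset.range r, p (e w i) (e w (i + 1)) ≠ 0 := by
    intro w
    by_cases hw : π (e w 0) * ∏ i ∈ Finset.range r, p (e w i) (e w (i + 1)) = 0
    · have h0 := h.law r (e w)
      rw [hw, measureReal_eq_zero_iff] at h0
      filter_upwards [measure_eq_zero_iff_ae_notMem.1 h0] with ω hω hω'
      exact absurd hω' hω
    · exact .of_forall fun ω _ => hw
  filter_upwards [ae_all_iff.2 hnull] with ω hω
  have he : ∀ i ≤ r, W i ω = e (fun j => W j ω) i := fun i hi => by simp [e, hi]
  have := hω (fun j => W j ω) he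
  rw [← he 0 (Nat.zero_le _)] at this
  convert this using 2
  refine Finset.prod_congr rfl fun i hi => ?_
  have hi' := Finset.mem_range.1 hi
  rw [he i hi'.le, he (i + 1) hi']

/-- The measure with the given weights on a finite set. -/
noncomputable def weightMeasure [Fintype S] (q : S → ℝ) : Measure S :=
  ∑ s, ENNReal.ofReal (q s) • Measure.dirac s

theorem weightMeasure_singleton [Fintype S] [DiscreteMeasurableSpace S] (q : S → ℝ) (s : S) :
    weightMeasure q {s} = ENNReal.ofReal (q s) := by
  classical
  rw [weightMeasure, Measure.finsetSum_apply, Finset.sum_eq_single s]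
  · simp
  · intro t _ hts
    simp [hts]
  · simp

theorem isProbabilityMeasure_weightMeasure [Fintype S] {q : S → ℝ} (h0 : ∀ s, 0 ≤ q s)
    (h1 : ∑ s, q s = 1) :
    IsProbabilityMeasure (weightMeasure q) := by
  constructor
  rw [weightMeasure, Measure.finsetSum_apply]
  simp only [Measure.smul_apply, measure_univ, smul_eq_mul, mul_one]
  rw [← ENNReal.ofReal_sum_of_nonneg fun s _ => h0 s, h1, ENNReal.ofReal_one]

/-- The trajectory that follows the independent random maps `x ↦ ω (k, x)`. -/
def randomMapPath (s₀ : S) (ω : ℕ × S → S) : ℕ → S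
  | 0 => ω (0, s₀)
  | k + 1 => ω (k + 1, randomMapPath s₀ ω k)

theorem measurable_randomMapPath [Countable S] [DiscreteMeasurableSpace S] (s₀ : S) (k : ℕ) :
    Measurable fun ω => randomMapPath s₀ ω k := by
  induction k with
  | zero => exact measurable_pi_apply _
  | succ k ih =>
    have h : Measurable fun q : (ℕ × S → S) × S => q.1 (k + 1, q.2) :=
      measurable_from_prod_countable_left fun s => measurable_pi_apply (k + 1, s)
    exact h.comp (measurable_id.prodMk ih)

/-- Independent choices are made for every time and state, including states not visited. A
prescribed initial path then fixes one coordinate per time, so the product measure yields the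
product formula. -/
theorem exists_isMarkovChain [Fintype S] [DiscreteMeasurableSpace S] [Nonempty S]
    {π : S → ℝ} {p : S → S → ℝ} (hπ0 : ∀ s, 0 ≤ π s) (hπ1 : ∑ s, π s = 1)
    (hp0 : ∀ s t, 0 ≤ p s t) (hp1 : ∀ s, ∑ t, p s t = 1) :
    ∃ P : Measure (ℕ → S), IsMarkovChain P (fun k s => s k) π p := by
  classical
  obtain ⟨s₀⟩ := ‹Nonempty S›
  let q : ℕ × S → S → ℝ := fun x => if x.1 = 0 then π else p x.2
  have hq0 : ∀ x s, 0 ≤ q x s := fun x s => by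
    simp only [q]; split_ifs; exacts [hπ0 s, hp0 _ s]
  have hq1 : ∀ x, ∑ s, q x s = 1 := fun x => by
    simp only [q]; split_ifs; exacts [hπ1, hp1 _]
  have hq : ∀ x, IsProbabilityMeasure (weightMeasure (q x)) := fun x =>
    isProbabilityMeasure_weightMeasure (hq0 x) (hq1 x)
  let M := Measure.infinitePi fun x => weightMeasure (q x)
  have hmeas : Measurable (randomMapPath s₀) :=
    measurable_pi_lambda _ fun k => measurable_randomMapPath s₀ k
  refine ⟨M.map (randomMapPath s₀), Measure.isProbabilityMeasure_map hmeas.aemeasurable,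
    fun k => measurable_pi_apply k, fun k s => ?_⟩
  -- At time 0 there is no previous state, and `s₀` only serves as an index.
  let prev : ℕ → S := fun i => if i = 0 then s₀ else s (i - 1)
  have hset : randomMapPath s₀ ⁻¹' {t | ∀ i ≤ k, t i = s i} =
      Set.pi ((Finset.range (k + 1)).image fun i => (i, prev i) : Finset (ℕ × S))
        (fun x => {s x.1}) := by
    ext ω
    simp only [Set.mem_preimage, Set.mem_ofPred_eq, Set.mem_pi, Finset.coe_image, Set.mem_image,
      Finset.coe_range, Set.mem_Iio, forall_exists_index, and_imp, forall_apply_eq_imp_iff₂,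
      Set.mem_singleton_iff, Nat.lt_succ_iff]
    constructor
    · intro h i hi
      rcases i with - | i
      · exact h 0 hi
      · rw [← h (i + 1) hi, randomMapPath, h i (by omega)]; rfl
    · intro h i
      induction i with
      | zero => exact fun hi => h 0 hi
      | succ i ih =>
        intro hi
        rw [randomMapPath, ih (by omega)]
        exact h (i + 1) hi
  have hms : MeasurableSet {t : ℕ → S | ∀ i ≤ k, t i = s i} :=
    measurableSet_path (fun k => measurable_pi_apply k) k s
  rw [Measure.real, Measure.map_apply hmeas hms, hset,
    Measure.infinitePi_pi _ fun x _ => measurableSet_singleton _,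
    Finset.prod_image fun i _ j _ hij => (Prod.ext_iff.1 hij).1]
  simp only [weightMeasure_singleton]
  rw [Finset.prod_range_succ', ENNReal.toReal_mul, ENNReal.toReal_prod, mul_comm]
  simp only [ENNReal.toReal_ofReal (hq0 _ _)]
  rfl

end MarkovChain

/-! ### The limit measure -/

theorem measurable_walk : Measurable (walk : (ℕ → State d) → ℕ → ℤ) := by
  refine measurable_pi_lambda _ fun k => ?_
  have : (fun t : ℕ → State d => walk t k) =
      (fun w : Fin (k + 1) → State d => walk (extend w) k) ∘ fun t j => t j := by
    funext t
    exact (walk_congr_of_le (n := k) (fun i hi => extend_restrict t hi) le_rfl).symm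
  rw [this]
  exact (measurable_of_countable _).comp (measurable_pi_lambda _ fun j => measurable_pi_apply _)

theorem measurableSet_ZHom_halfLineGraph : MeasurableSet (ZHom (halfLineGraph d) 0) := by
  have : ZHom (halfLineGraph d) 0 = {f | f 0 = 0} ∩
      ⋂ x, ⋂ y, ⋂ _ : (halfLineGraph d).Adj x y, {f | |f x - f y| = 1} := by
    ext f; simp [ZHom]
  rw [this]
  refine (measurable_pi_apply 0 (measurableSet_singleton _)).inter
    (MeasurableSet.iInter fun x => MeasurableSet.iInter fun y => MeasurableSet.iInter fun _ => ?_)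
  have hpair : Measurable fun f : ℕ → ℤ => (f x, f y) :=
    (measurable_pi_apply x).prodMk (measurable_pi_apply y)
  have habs : Measurable fun q : ℤ × ℤ => |q.1 - q.2| := measurable_of_countable _
  exact habs.comp hpair (measurableSet_singleton 1)

/-- Any path that is not permitted has probability zero, so almost surely every initial segment is
permitted. -/
theorem ae_mem_trajectories (hd : 1 ≤ d) (h : IsRate d lam) {Ω : Type*} [MeasurableSpace Ω]
    {P : Measure Ω} {W : ℕ → Ω → State d}
    (hW : IsMarkovChain P W (initial d lam) (trans d lam)) :
    ∀ᵐ ω ∂P, (fun k => W k ω) ∈ trajectories d d d := by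
  filter_upwards [hW.ae_ne_zero] with ω hω
  have hpath : ∀ r, PermittedPath d d (fun k => W k ω) r := fun r => by
    by_contra hr
    exact hω r (path_prob_of_not_permittedPath hd h hr)
  exact ⟨(hpath 0).1, fun i => (hpath (i + 1)).2 i (Nat.lt_succ_self i)⟩

theorem measureReal_walk_cylinder {P : Measure (ℕ → State d)}
    (hP : IsMarkovChain P (fun k s => s k) (initial d lam) (trans d lam)) {r : ℕ}
    (f : Fin (r + 1) → ℤ) :
    P.real {t | ∀ j : Fin (r + 1), walk t j = f j} =
      ∑ w ∈ compatiblePaths d r f, initial d lam (extend w 0) *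
        ∏ i ∈ Finset.range r, trans d lam (extend w i) (extend w (i + 1)) := by
  have := hP.prob
  have hU : {t : ℕ → State d | ∀ j : Fin (r + 1), walk t j = f j} =
      ⋃ w ∈ compatiblePaths d r f, {t | ∀ i ≤ r, t i = extend w i} := by
    ext t
    simp only [Set.mem_ofPred_eq, Set.mem_iUnion, exists_prop]
    rw [← restrict_mem_compatiblePaths_iff]
    constructor
    · exact fun h => ⟨_, h, fun i hi => (extend_restrict t hi).symm⟩
    · rintro ⟨w, hw, h⟩
      convert hw using 1
      exact extend_injective fun i hi => by rw [extend_restrict t hi, h i hi]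
  rw [hU, measureReal_biUnion_finset]
  · exact Finset.sum_congr rfl fun w _ => hP.law r (extend w)
  · intro w _ w' _ hne
    refine Set.disjoint_left.2 fun t ht ht' => hne (extend_injective fun i hi => ?_)
    rw [← ht i hi, ht' i hi]
  · exact fun w _ => measurableSet_path hP.meas r _

end LocalLimit

theorem theorem2p11 (d : ℕ) (hd : 1 ≤ d) :
    ∃ lam : ℝ, LocalLimit.IsRate d lam ∧ (∀ lam' : ℝ, LocalLimit.IsRate d lam' → lam' = lam) ∧
      -- `decode` is the inverse of the bijection `L_∞` from `Hom(P_{∞,d}, 0)` to the legal words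
      Set.BijOn LocalLimit.encode (LocalLimit.ZHom (LocalLimit.halfLineGraph d) 0)
        (LocalLimit.legalWords d) ∧
      Set.InvOn LocalLimit.decode LocalLimit.encode
        (LocalLimit.ZHom (LocalLimit.halfLineGraph d) 0) (LocalLimit.legalWords d) ∧
      ∃ μ : Measure (LocalLimit.ZHom (LocalLimit.halfLineGraph d) 0),
        IsProbabilityMeasure μ ∧
        -- local convergence
        (∀ (r : ℕ) (f : Fin (r + 1) → ℤ),
          Tendsto
            (fun n : ℕ => (LocalLimit.uniformHom n d).real (LocalLimit.finiteCylinder n d r f))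
            atTop (𝓝 (μ.real (LocalLimit.infiniteCylinder d r f)))) ∧
        -- the chain exists, and `μ` is the law of the decoded word of any such chain
        (∃ P : Measure (ℕ → LocalLimit.State d),
          LocalLimit.IsMarkovChain P (fun k s => s k) (LocalLimit.initial d lam)
            (LocalLimit.trans d lam)) ∧
        (∀ (Ω : Type*) [MeasurableSpace Ω] (P : Measure Ω) (W : ℕ → Ω → LocalLimit.State d),
          LocalLimit.IsMarkovChain P W (LocalLimit.initial d lam) (LocalLimit.trans d lam) →
          (∀ᵐ ω ∂P, LocalLimit.word W ω ∈ LocalLimit.legalWords d) ∧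
          P.map (fun ω => LocalLimit.decode (LocalLimit.word W ω)) = μ.map Subtype.val) := by
  obtain ⟨lam, h⟩ := LocalLimit.exists_isRate hd
  have hne : Nonempty (LocalLimit.State d) := ⟨.A⟩
  obtain ⟨P₀, hP₀⟩ := LocalLimit.exists_isMarkovChain (LocalLimit.initial_nonneg h)
    (LocalLimit.sum_initial hd) (LocalLimit.trans_nonneg hd h) (LocalLimit.sum_trans hd)
  have hprob := hP₀.prob
  have hν : IsProbabilityMeasure (P₀.map LocalLimit.walk) :=
    Measure.isProbabilityMeasure_map LocalLimit.measurable_walk.aemeasurable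
  have hH := LocalLimit.measurableSet_ZHom_halfLineGraph (d := d)
  have hwalk : ∀ t ∈ LocalLimit.trajectories d d d,
      LocalLimit.walk t ∈ LocalLimit.ZHom (LocalLimit.halfLineGraph d) 0 := fun t ht => by
    rw [← LocalLimit.walk_image_trajectories hd]; exact ⟨t, ht, rfl⟩
  have hsupp : ∀ᵐ f ∂P₀.map LocalLimit.walk,
      f ∈ LocalLimit.ZHom (LocalLimit.halfLineGraph d) 0 := by
    refine (ae_map_iff LocalLimit.measurable_walk.aemeasurable hH).2 ?_
    filter_upwards [LocalLimit.ae_mem_trajectories hd h hP₀] with t ht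
    exact hwalk t ht
  -- Pulling the law of the walk back to the subtype loses no mass, as it is carried by the
  -- homomorphisms.
  have hμ : ((P₀.map LocalLimit.walk).comap Subtype.val :
      Measure (LocalLimit.ZHom (LocalLimit.halfLineGraph d) 0)).map Subtype.val =
      P₀.map LocalLimit.walk := by
    rw [map_comap_subtype_coe hH, Measure.restrict_eq_self_of_ae_mem hsupp]
  refine ⟨lam, h, fun lam' h' => h.unique hd h', LocalLimit.bijOn_encode hd,
    LocalLimit.invOn_decode_encode hd, (P₀.map LocalLimit.walk).comap Subtype.val, ⟨?_⟩, ?_,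
    ⟨P₀, hP₀⟩, ?_⟩
  · rw [← Set.preimage_univ (f := Subtype.val), ← Measure.map_apply measurable_subtype_coe .univ,
      hμ, measure_univ]
  · intro r f
    have hcyl : MeasurableSet {g : ℕ → ℤ | ∀ j : Fin (r + 1), g j = f j} := by
      rw [Set.ofPred_forall]
      refine .iInter fun j => ?_
      have hj : Measurable fun g : ℕ → ℤ => g j := measurable_pi_apply (j : ℕ)
      exact hj (measurableSet_singleton (f j))
    have hreal : ((P₀.map LocalLimit.walk).comap Subtype.val).real
        (LocalLimit.infiniteCylinder d r f) =
        P₀.real {t | ∀ j : Fin (r + 1), LocalLimit.walk t j = f j} := by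
      change Measure.real _ (Subtype.val ⁻¹' {g : ℕ → ℤ | ∀ j : Fin (r + 1), g j = f j}) = _
      rw [← map_measureReal_apply measurable_subtype_coe hcyl, hμ,
        map_measureReal_apply LocalLimit.measurable_walk hcyl]
      rfl
    rw [hreal, LocalLimit.measureReal_walk_cylinder hP₀]
    exact LocalLimit.tendsto_uniformHom_finiteCylinder hd h f
  · intro Ω _ P W hW
    have hmeas : Measurable fun ω k => W k ω := measurable_pi_lambda _ hW.meas
    constructor
    · filter_upwards [LocalLimit.ae_mem_trajectories hd h hW] with ω hω
      rw [← LocalLimit.letters_image_trajectories hd]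
      exact ⟨_, hω, rfl⟩
    -- The decoded word is the image of the trajectory under `walk`, so equality of trajectory laws
    -- suffices.
    · have hlaw := hW.map_eq hP₀
      rw [Measure.map_id'] at hlaw
      rw [hμ, ← hlaw, Measure.map_map LocalLimit.measurable_walk hmeas]
      rfl
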